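/- Let $K$ be a field, $L/K$ a cyclic Galois extension of degree $n$, $\sigma$ a generator of $\mathrm{Gal}(L/K)$, and $R=L[x;\sigma]$ the skew polynomial ring with $xa=\sigma(a)x$ for $a\in L$. Coefficients are written on the left, $a(x)=\sum_i a_ix^i$. For $f\in R$ nonzero let $I(f)=\{g\in R: fg\in Rf\}$ and let $\mathcal E(f)=I(f)/Rf$ be the eigenring of $f$. A bound of $f$ is an element $f^*\in R$ with $Rf^*=f^*R=\mathrm{Ann}_R(R/Rf)$. For $F\in K[y]$ the element $F(x^n)$ is central in $R$; write $F_0=F(0)$ and $s=\deg F$. Suppose that $F(x^n)$ is a product of $m$ irreducible elements of $R$. (1) Let $F$ be monic and let $f\in R$ be monic and irreducible with $f_0\neq 0$ and with bound $F(x^n)$. Then $m\mid n$ and, with $\ell=n/m$, if $\deg f=s\ell$ then $$N_{L/K}(f_0)=(-1)^{s\ell(n-1)}F_0^{\ell}.$$ (2) Let $F$ be monic and irreducible in $K[y]$. Then $m\mid n$ and, with $\ell=n/m$, for every $h\in\{1,\dots,m\}$ and every monic divisor $g$ of $F(x^n)$ in $R$ of degree $sh\ell$, $$N_{L/K}(g_0)=(-1)^{sh\ell(n-1)}F_0^{h\ell}.$$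 (3) Let $F$ be monic and irreducible in $K[y]$, $F\neq y$, and let $f$ be an irreducible divisor of $F(x^n)$ in $R$. Then $m\mid n$; put $\ell=n/m$. The ring $\mathcal E(f)$ is a division ring, and there is an isomorphism $R/RF(x^n)\cong M_m(\mathcal E(f))$ that is linear over the centre of $R/RF(x^n)$ (the class of a central $c\in R$ goes to the scalar matrix with entry $c+Rf$). For every ring isomorphism $R/RF(x^n)\cong M_m(\mathcal E(f))$, define the rank of $a\in R$ as the rank of the matrix corresponding to $a+RF(x^n)$, that is, the dimension of the right $\mathcal E(f)$-vector space generated by its columns. Let $0\le k\le m$ and let $a(x)\in R$ be a nonzero skew polynomial of degree at most $sk\ell$. Then the rank of $a(x)$ is at least $m-k$. If the rank is equal to $m-k$, then $\deg a=sk\ell$ and $$\frac{N_{L/K}(a_0)}{N_{L/K}(a_{sk\ell})}=(-1)^{sk\ell(n-1)}F_0^{k\ell}.$$ -/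

import Mathlib

section Ring

variable {R : Type*} [Ring R]

/-- `z` is a product of `m` irreducible elements. -/
def IsProductOfIrreducibles (z : R) (m : ℕ) : Prop :=
  ∃ l : List R, l.length = m ∧ (∀ q ∈ l, Irreducible q) ∧ l.prod = z

/-- `p` is a bound of `f`: it is two-sided (`Rp = pR`) and `Rp = Ann(R / Rf)`, the largest
two-sided ideal contained in `Rf`. -/
def IsBound (f p : R) : Prop :=
  ((Ideal.span {p} : Ideal R) : Set R) = Set.range (fun r : R => p * r) ∧
    (Ideal.span {p} : Ideal R) = Module.annihilator R (R ⧸ (Ideal.span {f} : Ideal R))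

/-- The left idealiser `I(f) = {g | f g ∈ R f}`. -/
def leftIdealizer (f : R) : Subring R where
  carrier := {g | f * g ∈ Ideal.span {f}}
  mul_mem' := by
    intro a b ha hb
    simp only [Set.mem_ofPred_eq, Ideal.mem_span_singleton'] at *
    obtain ⟨c, hc⟩ := ha
    obtain ⟨d, hd⟩ := hb
    exact ⟨c * d, by rw [mul_assoc, hd, ← mul_assoc, hc, mul_assoc]⟩
  one_mem' := by
    simp
  add_mem' := by
    intro a b ha hb
    simp only [Set.mem_ofPred_eq, mul_add] at *
    exact Ideal.add_mem _ ha hb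
  zero_mem' := by simp
  neg_mem' := by
    intro a ha
    simp only [Set.mem_ofPred_eq, mul_neg] at *
    exact (Ideal.neg_mem_iff _).2 ha

theorem mem_leftIdealizer {f g : R} : g ∈ leftIdealizer f ↔ f * g ∈ Ideal.span {f} := Iff.rfl

/-- The left ideal `R f`, seen inside the idealiser `I(f)`. -/
def idealInIdealizer (f : R) : Ideal (leftIdealizer f) :=
  (Ideal.span {f}).comap (leftIdealizer f).subtype

instance idealInIdealizer_isTwoSided (f : R) : (idealInIdealizer f).IsTwoSided where
  mul_mem_of_left := by
    intro a b ha
    simp only [idealInIdealizer, Ideal.mem_comap, map_mul, Subring.subtype_apply] at *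
    obtain ⟨c, hc⟩ := Ideal.mem_span_singleton'.1 ha
    rw [← hc, mul_assoc]
    exact Ideal.mul_mem_left _ _ b.2

/-- The eigenring `E(f) = I(f) / R f`. -/
abbrev Eigenring (f : R) : Type _ := leftIdealizer f ⧸ idealInIdealizer f

theorem center_le_leftIdealizer (f : R) : Subring.center R ≤ leftIdealizer f := by
  intro c hc
  rw [mem_leftIdealizer, Subring.mem_center_iff.1 hc f]
  exact Ideal.mul_mem_left _ _ (Ideal.mem_span_singleton_self f)

/-- The map `c ↦ c + R f` from the centre of `R` to `E(f)`. -/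
def centerToEigenring (f : R) : Subring.center R →+* Eigenring f :=
  (Ideal.Quotient.mk (idealInIdealizer f)).comp (Subring.inclusion (center_le_leftIdealizer f))

/-- Every nonzero element is invertible, and `1 ≠ 0`. -/
def IsDivRing (D : Type*) [Ring D] : Prop :=
  Nontrivial D ∧ ∀ x : D, x ≠ 0 → IsUnit x

/-- The rank of a square matrix over a division ring `D`: the dimension of the right
`D`-vector space generated by its columns. -/
noncomputable def matrixRank {D : Type*} [Ring D] {m : ℕ} (A : Matrix (Fin m) (Fin m) D) : ℕ :=
  Module.finrank Dᵐᵒᵖ (Submodule.span Dᵐᵒᵖ (Set.range A.col))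

end Ring

section Skew

variable {K L : Type*} [Field K] [Field L] [Algebra K L]

/-- The action of `ℕ` on `L` through the powers of `σ`. -/
@[reducible] def skewAction (σ : L ≃ₐ[K] L) : MulSemiringAction (Multiplicative ℕ) L :=
  MulSemiringAction.compHom L (powersHom (L ≃ₐ[K] L) σ)

/-- The skew polynomial ring `L[x; σ]`, in which `x a = σ(a) x`. -/
def SkewRing (_σ : L ≃ₐ[K] L) : Type _ := SkewPolynomial L

noncomputable instance (σ : L ≃ₐ[K] L) : Ring (SkewRing σ) :=
  letI := skewAction σ
  inferInstanceAs (Ring (SkewPolynomial L))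

namespace SkewRing

variable {σ : L ≃ₐ[K] L}

/-- The coefficient of `x ^ i`, coefficients being written on the left: `a = ∑ a_i x ^ i`. -/
noncomputable def coeff (a : SkewRing σ) (i : ℕ) : L :=
  SkewPolynomial.coeff (R := L) a i

/-- The degree, with the convention that it is `0` for the zero polynomial. -/
noncomputable def natDegree (a : SkewRing σ) : ℕ :=
  (SkewPolynomial.support (R := L) a).sup id

def Monic (a : SkewRing σ) : Prop := a.coeff a.natDegree = 1

variable (σ)

/-- The constant skew polynomials. -/
noncomputable def C : L →+* SkewRing σ :=
  letI := skewAction σ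
  (SkewPolynomial.CRingHom : L →+* SkewPolynomial L)

/-- The indeterminate `x`. -/
noncomputable def x : SkewRing σ := (SkewPolynomial.X : SkewPolynomial L)

theorem x_mul_C (a : L) : x σ * C σ a = C σ (σ a) * x σ := by
  let inst := skewAction σ
  have h : (SkewPolynomial.X * SkewPolynomial.CRingHom a : SkewPolynomial L)
      = SkewPolynomial.CRingHom (σ a) * SkewPolynomial.X := by
    rw [SkewPolynomial.CRingHom_eq_C, SkewPolynomial.CRingHom_eq_C,
      SkewPolynomial.C_mul_X_eq_monomial, ← SkewPolynomial.monomial_zero_left,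
      SkewPolynomial.X_mul_monomial]
    rfl
  exact h

theorem x_pow_mul_C (n : ℕ) (a : L) : x σ ^ n * C σ a = C σ ((σ ^ n) a) * x σ ^ n := by
  induction n generalizing a with
  | zero => simp
  | succ n ih =>
    rw [pow_succ, mul_assoc, x_mul_C, ← mul_assoc, ih, mul_assoc, pow_succ]
    rfl

theorem induction {p : SkewRing σ → Prop} (a : SkewRing σ) (h0 : p 0)
    (hadd : ∀ a b, p a → p b → p (a + b)) (hmon : ∀ (c : L) (i : ℕ), p (C σ c * x σ ^ i)) :
    p a := by
  let inst := skewAction σ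
  refine SkewPolynomial.induction (R := L) (motive := p) a h0 ?_
  intro i c q _ _ hq
  refine hadd _ _ ?_ hq
  have e : (SkewPolynomial.CRingHom c * SkewPolynomial.X ^ i : SkewPolynomial L)
      = SkewPolynomial.monomial i c := by
    rw [SkewPolynomial.CRingHom_eq_C, ← SkewPolynomial.monomial_one_right_eq_X_pow,
      SkewPolynomial.C_mul_monomial, mul_one]
  rw [← e]
  exact hmon c i

/-- The skew polynomial `F(x ^ n)`, where `F ∈ K[y]` and `n = [L : K]`. -/
noncomputable def central (F : Polynomial K) : SkewRing σ :=
  F.eval₂ ((C σ).comp (algebraMap K L)) (x σ ^ Module.finrank K L)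

theorem commute_C (c : K) (a : SkewRing σ) : Commute (C σ (algebraMap K L c)) a := by
  have hx : Commute (C σ (algebraMap K L c)) (x σ) := by
    change _ * _ = _ * _
    rw [x_mul_C, AlgEquiv.commutes]
  refine induction σ (p := fun a => Commute (C σ (algebraMap K L c)) a) a
    (Commute.zero_right _) (fun _ _ => Commute.add_right) ?_
  intro d i
  refine Commute.mul_right ?_ (hx.pow_right i)
  change _ * _ = _ * _
  rw [← map_mul, ← map_mul, mul_comm]

variable [FiniteDimensional K L] [IsGalois K L]

theorem commute_x_pow (a : SkewRing σ) : Commute (x σ ^ Module.finrank K L) a := by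
  refine induction σ (p := fun a => Commute (x σ ^ Module.finrank K L) a) a
    (Commute.zero_right _) (fun _ _ => Commute.add_right) ?_
  intro d i
  refine Commute.mul_right ?_ ((Commute.refl (x σ)).pow_pow _ _)
  change _ * _ = _ * _
  rw [x_pow_mul_C, ← IsGalois.card_aut_eq_finrank K L, pow_card_eq_one', AlgEquiv.one_apply]

theorem commute_central (F : Polynomial K) (a : SkewRing σ) : Commute (central σ F) a := by
  unfold central
  rw [Polynomial.eval₂_eq_sum, Polynomial.sum]
  refine Commute.sum_left _ _ _ fun i _ => ?_
  exact (commute_C σ _ a).mul_left ((commute_x_pow σ a).pow_left i)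

instance span_central_isTwoSided (F : Polynomial K) :
    (Ideal.span {central σ F} : Ideal (SkewRing σ)).IsTwoSided where
  mul_mem_of_left := by
    intro a b ha
    obtain ⟨c, hc⟩ := Ideal.mem_span_singleton'.1 ha
    rw [← hc, mul_assoc, (commute_central σ F b).eq, ← mul_assoc]
    exact Ideal.mul_mem_left _ _ (Ideal.mem_span_singleton_self _)

/-- The quotient ring `R_F = R / R F(x ^ n)` of `R = L[x; σ]`. -/
abbrev RF (F : Polynomial K) : Type _ :=
  SkewRing σ ⧸ (Ideal.span {central σ F} : Ideal (SkewRing σ))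

/-- The class `a + R F(x ^ n)` of a skew polynomial `a`. -/
noncomputable def toRF (F : Polynomial K) : SkewRing σ →+* RF σ F :=
  Ideal.Quotient.mk (Ideal.span {central σ F} : Ideal (SkewRing σ))

/-- A ring isomorphism `R_F ≅ M_m(E(f))` is linear over the centre `E_F` of `R_F`, whose elements
are the classes of the central elements of `R`: the class of a central `c` goes to the scalar
matrix with entry `c + R f`. -/
def IsCenterLinear {F : Polynomial K} {f : SkewRing σ} {m : ℕ}
    (φ : RF σ F ≃+* Matrix (Fin m) (Fin m) (Eigenring f)) : Prop :=
  ∀ c : Subring.center (SkewRing σ),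
    φ (toRF σ F c) = Matrix.diagonal fun _ => centerToEigenring f c

end SkewRing

end Skew

/-!
The proof rests on the reduced norm of `R = L[x; σ]`. With `t = x ^ n`, the ring `R` is a free left
module over `L[t]` with basis `1, x, …, x ^ (n - 1)`, and right multiplication on it represents `R` by
matrices over `L[t]`; the determinant of this representation is a multiplicative map `Nrd` with values
in `L[t]` (`SkewRing.reducedNorm`). Over `L[u]` with `u ^ n = t` a diagonal conjugation makes the
representation homogeneous (`SkewRing.expand_reducedNorm`), and this shows that `Nrd a` has the degree
of `a`, constant coefficient `N(a_0)` and leading coefficient `(-1) ^ (d (n - 1)) N(a_d)`, where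
`d = deg a`. Moreover `Nrd F(x ^ n) = F ^ n`, and `Nrd a` has coefficients in `K`, because conjugation
by `x` applies `σ` to it (`SkewRing.exists_map_eq_reducedNorm`). So if `F` is irreducible, the reduced
norm of a divisor of `F(x ^ n)` is a constant times a power of `F`. The degree determines the power,
and the comparison of constant and leading coefficients gives the norm formula
(`SkewRing.norm_coeff_zero_of_reducedNorm_eq`).

If `f` is irreducible, then `R / R f` is a simple module, and `E(f)` is the opposite of its
endomorphism ring, hence a division ring. If `F(x ^ n)` is a bound of `f` and `F = G H`, then
`G(x ^ n) H(x ^ n)` is zero in `E(f)`, so that one factor annihilates `R / R f`: a bound comes from an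
irreducible `F` (`SkewRing.irreducible_of_annihilator_eq`).

For irreducible `F ≠ y` the ring `R / R F(x ^ n)` is simple: an element of least degree of a two-sided
ideal is, once made monic, central (`SkewRing.eq_top_or_eq_span_central`). Consequently the modules
`R / R q`, for irreducible divisors `q` of `F(x ^ n)`, are all isomorphic, so the `m` irreducible
factors have the same degree. Being the degree of a power of `F`, it is a multiple of `s`, which gives
`m ∣ n` and `deg q = s ℓ` (`SkewRing.dvd_finrank_and_natDegree_eq`). The `R / R f`-isotypic component
of `R / R F(x ^ n)` is a two-sided ideal, hence everything, and
`R / R F(x ^ n) ≃ (R / R f) ^ m` as left modules; taking endomorphisms turns this into the isomorphism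
with `M_m(E(f))`.

The rank is recovered from dimensions over `K`. Let `φ` be any ring isomorphism of `R / R F(x ^ n)`
with `M_m(E(f))` and let `r` be the rank of `φ a`. The right ideal generated by `φ a` is isomorphic to
a sum of `r` of the `m` rows of the matrix ring, and it is made a `K`-vector space through `φ` itself,
since `φ` is not assumed to be linear (`mul_finrank_range_mulLeft`). On the other hand
`a R + F(x ^ n) R = g R` for a divisor `g` of `F(x ^ n)`, and the quotient by the right ideal generated
by `a` has dimension `n deg g`. Hence `deg g = (m - r) s ℓ` (`SkewRing.exists_gcd_natDegree_eq`). As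
`g` divides `a`, a nonzero `a` of degree at most `s k ℓ` has rank at least `m - k`, and in case of
equality `a` is `g` times a constant, so that the norm formula applies to it.
-/

/-! ### Coefficients and degrees of skew polynomials -/

namespace SkewRing

section Coefficients

variable {K L : Type*} [Field K] [Field L] [Algebra K L] {σ : L ≃ₐ[K] L}

theorem ext {a b : SkewRing σ} (h : ∀ i, a.coeff i = b.coeff i) : a = b :=
  SkewPolynomial.ext (R := L) h

@[simp] theorem coeff_zero (i : ℕ) : (0 : SkewRing σ).coeff i = 0 := rfl

@[simp] theorem coeff_add (a b : SkewRing σ) (i : ℕ) :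
    (a + b).coeff i = a.coeff i + b.coeff i :=
  SkewPolynomial.coeff_add (R := L) a b i

@[simp] theorem coeff_neg (a : SkewRing σ) (i : ℕ) : (-a).coeff i = -a.coeff i :=
  eq_neg_of_add_eq_zero_left (by rw [← coeff_add, neg_add_cancel, coeff_zero])

@[simp] theorem coeff_sub (a b : SkewRing σ) (i : ℕ) :
    (a - b).coeff i = a.coeff i - b.coeff i := by
  rw [sub_eq_add_neg, coeff_add, coeff_neg, sub_eq_add_neg]

theorem coeff_sum {ι : Type*} (s : Finset ι) (f : ι → SkewRing σ) (i : ℕ) :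
    (∑ j ∈ s, f j).coeff i = ∑ j ∈ s, (f j).coeff i := by
  classical
  induction s using Finset.induction_on with
  | empty => simp
  | insert a s ha ih => rw [Finset.sum_insert ha, Finset.sum_insert ha, coeff_add, ih]

theorem coeff_C_mul_x_pow (c : L) (i j : ℕ) :
    (C σ c * x σ ^ i).coeff j = if i = j then c else 0 := by
  let inst := skewAction σ
  have e : (SkewPolynomial.CRingHom c * SkewPolynomial.X ^ i : SkewPolynomial L)
      = SkewPolynomial.monomial i c := by
    rw [SkewPolynomial.CRingHom_eq_C, ← SkewPolynomial.monomial_one_right_eq_X_pow,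
      SkewPolynomial.C_mul_monomial, mul_one]
  have h : SkewPolynomial.coeff (SkewPolynomial.CRingHom c * SkewPolynomial.X ^ i :
      SkewPolynomial L) j = if i = j then c else 0 := by
    rw [e, SkewPolynomial.coeff_monomial]
  exact h

theorem coeff_C (c : L) (j : ℕ) : (C σ c).coeff j = if j = 0 then c else 0 := by
  simpa [eq_comm] using coeff_C_mul_x_pow (σ := σ) c 0 j

theorem coeff_x_pow (i j : ℕ) : (x σ ^ i).coeff j = if i = j then 1 else 0 := by
  simpa using coeff_C_mul_x_pow (σ := σ) 1 i j

@[simp] theorem coeff_C_mul (c : L) (a : SkewRing σ) (i : ℕ) :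
    (C σ c * a).coeff i = c * a.coeff i := by
  refine induction σ (p := fun a => (C σ c * a).coeff i = c * a.coeff i) a (by simp)
    (fun a b ha hb => by rw [mul_add, coeff_add, coeff_add, ha, hb, mul_add]) fun d j => ?_
  rw [← mul_assoc, ← map_mul, coeff_C_mul_x_pow, coeff_C_mul_x_pow, mul_ite, mul_zero]

@[simp] theorem coeff_mul_C (c : L) (a : SkewRing σ) (i : ℕ) :
    (a * C σ c).coeff i = a.coeff i * (σ ^ i) c := by
  refine induction σ (p := fun a => (a * C σ c).coeff i = a.coeff i * (σ ^ i) c) a (by simp)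
    (fun a b ha hb => by rw [add_mul, coeff_add, coeff_add, ha, hb, add_mul]) fun d j => ?_
  rw [mul_assoc, x_pow_mul_C, ← mul_assoc, ← map_mul, coeff_C_mul_x_pow, coeff_C_mul_x_pow]
  split_ifs with h
  · rw [h]
  · rw [zero_mul]

theorem coeff_mul_x_pow (a : SkewRing σ) (k i : ℕ) :
    (a * x σ ^ k).coeff i = if k ≤ i then a.coeff (i - k) else 0 := by
  refine induction σ (p := fun a => (a * x σ ^ k).coeff i = if k ≤ i then a.coeff (i - k) else 0)
    a (by simp) (fun a b ha hb => ?_) fun d j => ?_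
  · rw [add_mul, coeff_add, ha, hb]
    split_ifs <;> simp
  · rw [mul_assoc, ← pow_add, coeff_C_mul_x_pow, coeff_C_mul_x_pow, ← ite_and]
    exact if_congr (by omega) rfl rfl

theorem coeff_x_pow_mul (a : SkewRing σ) (k i : ℕ) :
    (x σ ^ k * a).coeff i = if k ≤ i then (σ ^ k) (a.coeff (i - k)) else 0 := by
  refine induction σ
    (p := fun a => (x σ ^ k * a).coeff i = if k ≤ i then (σ ^ k) (a.coeff (i - k)) else 0)
    a (by simp) (fun a b ha hb => ?_) fun d j => ?_
  · rw [mul_add, coeff_add, ha, hb]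
    split_ifs <;> simp
  · rw [← mul_assoc, x_pow_mul_C, mul_assoc, ← pow_add, coeff_C_mul_x_pow, coeff_C_mul_x_pow,
      apply_ite (σ ^ k), map_zero, ← ite_and]
    exact if_congr (by omega) rfl rfl

@[simp] theorem coeff_x_mul_succ (a : SkewRing σ) (i : ℕ) :
    (x σ * a).coeff (i + 1) = σ (a.coeff i) := by
  have h := coeff_x_pow_mul a 1 (i + 1)
  rwa [pow_one, if_pos (by omega), pow_one, Nat.add_sub_cancel] at h

@[simp] theorem coeff_x_mul_zero (a : SkewRing σ) : (x σ * a).coeff 0 = 0 := by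
  have h := coeff_x_pow_mul a 1 0
  rwa [pow_one, if_neg (by omega)] at h

@[simp] theorem coeff_mul_x_succ (a : SkewRing σ) (i : ℕ) :
    (a * x σ).coeff (i + 1) = a.coeff i := by
  have h := coeff_mul_x_pow a 1 (i + 1)
  rwa [pow_one, if_pos (by omega), Nat.add_sub_cancel] at h

@[simp] theorem coeff_mul_x_zero (a : SkewRing σ) : (a * x σ).coeff 0 = 0 := by
  have h := coeff_mul_x_pow a 1 0
  rwa [pow_one, if_neg (by omega)] at h

theorem le_natDegree {a : SkewRing σ} {i : ℕ} (h : a.coeff i ≠ 0) : i ≤ a.natDegree :=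
  Finset.le_sup (f := id) ((SkewPolynomial.mem_support_iff (R := L)).2 h)

theorem coeff_eq_zero_of_natDegree_lt {a : SkewRing σ} {i : ℕ} (h : a.natDegree < i) :
    a.coeff i = 0 := by
  by_contra h0
  exact absurd (le_natDegree h0) (by omega)

theorem natDegree_le {a : SkewRing σ} {d : ℕ} (h : ∀ i, d < i → a.coeff i = 0) :
    a.natDegree ≤ d := by
  refine Finset.sup_le fun i hi => ?_
  by_contra h0
  exact (SkewPolynomial.mem_support_iff (R := L)).1 hi (h i (by simpa using h0))

theorem coeff_natDegree_ne_zero {a : SkewRing σ} (ha : a ≠ 0) : a.coeff a.natDegree ≠ 0 := by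
  have hs : (SkewPolynomial.support (R := L) a).Nonempty :=
    Finset.nonempty_iff_ne_empty.2 fun h => ha ((SkewPolynomial.support_eq_empty (R := L)).1 h)
  obtain ⟨i, hi, e⟩ := Finset.exists_mem_eq_sup _ hs id
  have := (SkewPolynomial.mem_support_iff (R := L)).1 hi
  have e' : a.natDegree = i := e
  rw [e']
  exact this

theorem Monic.ne_zero {a : SkewRing σ} (ha : a.Monic) : a ≠ 0 := by
  rintro rfl
  exact zero_ne_one (α := L) ha

theorem natDegree_lt {a : SkewRing σ} {d : ℕ} (ha : a ≠ 0) (h : ∀ i, d ≤ i → a.coeff i = 0) :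
    a.natDegree < d := by
  by_contra h0
  exact coeff_natDegree_ne_zero ha (h _ (by omega))

theorem eq_C_of_natDegree_eq_zero {a : SkewRing σ} (h : a.natDegree = 0) :
    a = C σ (a.coeff 0) := by
  refine ext fun i => ?_
  rw [coeff_C]
  split_ifs with hi
  · rw [hi]
  · exact coeff_eq_zero_of_natDegree_lt (by omega)

instance : Nontrivial (SkewRing σ) :=
  ⟨0, 1, fun h => by
    have : (C σ 1).coeff 0 = 0 := by rw [map_one, ← h, coeff_zero]
    rw [coeff_C, if_pos rfl] at this
    exact one_ne_zero this⟩

theorem coeff_x (i : ℕ) : (x σ).coeff i = if 1 = i then 1 else 0 := by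
  rw [← pow_one (x σ), coeff_x_pow]

theorem x_ne_zero : x σ ≠ 0 := fun h => by
  have := coeff_x (σ := σ) 1
  rw [h, coeff_zero, if_pos rfl] at this
  exact zero_ne_one this

theorem natDegree_x : (x σ).natDegree = 1 :=
  le_antisymm (natDegree_le fun i hi => by rw [coeff_x, if_neg (by omega)])
    (le_natDegree (by rw [coeff_x, if_pos rfl]; exact one_ne_zero))

/-- The universal property of the skew polynomial ring: a ring homomorphism `φ` on the
coefficients and an element `X` with `X φ(c) = φ(σ c) X` determine a ring homomorphism. -/
noncomputable def lift {B : Type*} [Ring B] (φ : L →+* B) (X : B)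
    (h : ∀ c, X * φ c = φ (σ c) * X) : SkewRing σ →+* B :=
  letI := skewAction σ
  (SkewMonoidAlgebra.liftNCRingHom φ (powersHom B X) (by
    intro c k
    have key : ∀ (i : ℕ) (c : L), φ ((σ ^ i) c) * X ^ i = X ^ i * φ c := by
      intro i
      induction i with
      | zero => simp
      | succ i ih =>
        intro c
        rw [pow_succ, pow_succ X, mul_assoc (X ^ i), h, ← mul_assoc, ← mul_assoc, ← ih]
        rfl
    exact key (Multiplicative.toAdd k) c) : SkewPolynomial L →+* B)

section lift

variable {B : Type*} [Ring B] (φ : L →+* B) (X : B) (h : ∀ c, X * φ c = φ (σ c) * X)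

@[simp] theorem lift_C (c : L) : lift φ X h (C σ c) = φ c := by
  have : SkewMonoidAlgebra.liftNC (φ : L →+ B) (powersHom B X)
      (SkewMonoidAlgebra.single (1 : Multiplicative ℕ) c) = φ c := by
    rw [SkewMonoidAlgebra.liftNC_single]
    simp
  exact this

@[simp] theorem lift_x : lift φ X h (x σ) = X := by
  have : SkewMonoidAlgebra.liftNC (φ : L →+ B) (powersHom B X)
      (SkewMonoidAlgebra.single (Multiplicative.ofAdd 1) (1 : L)) = X := by
    rw [SkewMonoidAlgebra.liftNC_single]
    simp
  exact this

end lift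

/-- `K` is central in `L[x; σ]`, because `σ` fixes it. -/
noncomputable instance : Algebra K (SkewRing σ) :=
  RingHom.toAlgebra' ((C σ).comp (algebraMap K L)) fun c a => (commute_C σ c a).eq

theorem algebraMap_eq_C (c : K) : algebraMap K (SkewRing σ) c = C σ (algebraMap K L c) := rfl

end Coefficients

end SkewRing

/-! ### Determinants of polynomial matrices -/

section PolynomialMatrix

open Polynomial

variable {ι R : Type*} [Fintype ι] [DecidableEq ι] [CommRing R]

theorem Matrix.natDegree_det_le_of_natDegree_le (M : Matrix ι ι R[X]) (d : ℕ)
    (h : ∀ i j, (M i j).natDegree ≤ d) : M.det.natDegree ≤ Fintype.card ι * d := by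
  rw [Matrix.det_apply]
  refine natDegree_sum_le_of_forall_le _ _ fun τ _ => ?_
  refine (natDegree_smul_le _ _).trans ((natDegree_prod_le _ _).trans ?_)
  refine (Finset.sum_le_card_nsmul _ _ d fun i _ => h _ _).trans ?_
  simp

theorem Matrix.coeff_det_of_natDegree_le (M : Matrix ι ι R[X]) (d : ℕ)
    (h : ∀ i j, (M i j).natDegree ≤ d) :
    M.det.coeff (Fintype.card ι * d) = (M.map fun p => p.coeff d).det := by
  rw [Matrix.det_apply, Matrix.det_apply, finsetSum_coeff]
  refine Finset.sum_congr rfl fun τ _ => ?_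
  rw [coeff_smul, ← Finset.card_univ,
    coeff_prod_of_natDegree_le _ _ _ fun i _ => h _ _]
  rfl

theorem Matrix.coeff_zero_det (M : Matrix ι ι R[X]) :
    M.det.coeff 0 = (M.map fun p => p.coeff 0).det := by
  have := RingHom.map_det (Polynomial.constantCoeff (R := R)) M
  simpa [Polynomial.constantCoeff_apply] using! this

end PolynomialMatrix

/-! ### The reduced norm -/

theorem val_finRotate {n : ℕ} (i : Fin n) :
    (finRotate n i : ℕ) = if (i : ℕ) + 1 = n then 0 else (i : ℕ) + 1 := by
  cases n with
  | zero => exact i.elim0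
  | succ n =>
    rw [coe_finRotate]
    refine if_congr ?_ rfl rfl
    rw [Fin.ext_iff, Fin.val_last]
    omega

theorem finRotate_pow_self (n : ℕ) : finRotate n ^ n = 1 := by
  have h : ∀ (k : ℕ) (i : Fin n), ((finRotate n ^ k) i : ℕ) = (i + k) % n := by
    intro k i
    induction k with
    | zero => exact (Nat.mod_eq_of_lt i.2).symm
    | succ k ih =>
      rw [pow_succ', Equiv.Perm.mul_apply, val_finRotate, ih, ← add_assoc, ← Nat.mod_add_mod (i + k) n 1]
      have := Nat.mod_lt (i + k) i.pos
      split_ifs with h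
      · rw [h, Nat.mod_self]
      · exact (Nat.mod_eq_of_lt (by omega)).symm
  refine Equiv.ext fun i => Fin.ext ?_
  rw [h, Nat.add_mod_right, Nat.mod_eq_of_lt i.2]
  rfl

namespace SkewRing

open Polynomial

variable {K L : Type*} [Field K] [Field L] [Algebra K L]

section rep

variable [FiniteDimensional K L] [IsGalois K L]

theorem pow_finrank_eq_one (σ : L ≃ₐ[K] L) : σ ^ Module.finrank K L = 1 := by
  rw [← IsGalois.card_aut_eq_finrank K L, pow_card_eq_one']

theorem pow_finRotate (σ : L ≃ₐ[K] L) (i : Fin (Module.finrank K L)) :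
    σ ^ (finRotate _ i : ℕ) = σ ^ ((i : ℕ) + 1) := by
  rw [val_finRotate]
  split_ifs with h
  · rw [h, pow_finrank_eq_one, pow_zero]
  · rfl

/-- The diagonal matrix with entries `c, σ c, σ² c, …`. -/
noncomputable def conjDiagonal (σ : L ≃ₐ[K] L) :
    L →+* Matrix (Fin (Module.finrank K L)) (Fin (Module.finrank K L)) L :=
  (Matrix.diagonalRingHom _ L).comp
    (RingHom.pi fun i : Fin (Module.finrank K L) => ((σ ^ (i : ℕ) : L ≃ₐ[K] L) : L →+* L))

omit [FiniteDimensional K L] [IsGalois K L] in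
theorem conjDiagonal_apply (σ : L ≃ₐ[K] L) (c : L) :
    conjDiagonal σ c = Matrix.diagonal fun i : Fin (Module.finrank K L) => (σ ^ (i : ℕ)) c := rfl

/-- The weighted cyclic shift: the entry at `(i, i + 1 mod n)` is `w i`. -/
noncomputable def shift {B : Type*} [CommRing B] {n : ℕ} (w : Fin n → B) : Matrix (Fin n) (Fin n) B :=
  Matrix.diagonal w * (finRotate n).permMatrix B

theorem shift_apply {B : Type*} [CommRing B] {n : ℕ} (w : Fin n → B) (i j : Fin n) :
    shift w i j = if finRotate n i = j then w i else 0 := by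
  rw [shift, Matrix.diagonal_mul, Equiv.Perm.permMatrix, PEquiv.toMatrix_apply]
  simp [eq_comm]

/-- For each weight `w` there is a representation of `L[x; σ]` by matrices over `L[t]`: a constant
`c` acts as `diag(c, σ c, σ² c, …)` and `x` as the cyclic shift with weight `w`. -/
noncomputable def rep (σ : L ≃ₐ[K] L) (w : Fin (Module.finrank K L) → L[X]) :
    SkewRing σ →+* Matrix (Fin (Module.finrank K L)) (Fin (Module.finrank K L)) L[X] :=
  lift ((Polynomial.C : L →+* L[X]).mapMatrix.comp (conjDiagonal σ)) (shift w) (by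
    intro c
    ext1 i j
    rw [RingHom.comp_apply, RingHom.comp_apply, conjDiagonal_apply, conjDiagonal_apply,
      RingHom.mapMatrix_apply, RingHom.mapMatrix_apply, Matrix.diagonal_map (map_zero _),
      Matrix.diagonal_map (map_zero _), Matrix.mul_diagonal, Matrix.diagonal_mul, shift_apply]
    split_ifs with h
    · rw [← h, pow_finRotate, pow_succ, mul_comm]
      rfl
    · simp)

variable (σ : L ≃ₐ[K] L) (w : Fin (Module.finrank K L) → L[X])

@[simp] theorem rep_C (c : L) :
    rep σ w (C σ c) = (Polynomial.C : L →+* L[X]).mapMatrix (conjDiagonal σ c) := lift_C _ _ _ c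

@[simp] theorem rep_x : rep σ w (x σ) = shift w := lift_x _ _ _

/-- The homogeneous weight, `x` acting as `u` times the cyclic permutation matrix: the
coefficients in `u` of a matrix are read off from those of the skew polynomial. -/
noncomputable abbrev homogeneousRep := rep σ (fun _ => (X : L[X]))

/-- The weight `(1, …, 1, t)`: the representation of `L[x; σ]` by right multiplication on itself,
in the basis `1, x, …, x ^ (n - 1)` over `L[t]`, where `t = x ^ n`. -/
noncomputable abbrev regularRep :=
  rep σ (fun i => if (i : ℕ) + 1 = Module.finrank K L then (X : L[X]) else 1)

/-- The reduced norm of `L[x; σ]`, with values in `L[t]`, where `t = x ^ n`. -/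
noncomputable def reducedNorm : SkewRing σ →* L[X] :=
  (Matrix.detMonoidHom).comp (regularRep σ).toMonoidHom

theorem reducedNorm_apply (a : SkewRing σ) : reducedNorm σ a = (regularRep σ a).det := rfl

theorem coeff_homogeneousRep (a : SkewRing σ) (k : ℕ) :
    (homogeneousRep σ a).map (fun p => p.coeff k) =
      conjDiagonal σ (a.coeff k) * (finRotate (Module.finrank K L)).permMatrix L ^ k := by
  refine induction σ (p := fun a => (homogeneousRep σ a).map (fun p => p.coeff k) =
    conjDiagonal σ (a.coeff k) * (finRotate (Module.finrank K L)).permMatrix L ^ k) a ?_ ?_ ?_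
  · ext1 i j
    simp
  · intro a b ha hb
    rw [coeff_add, map_add (conjDiagonal σ), add_mul, ← ha, ← hb, map_add]
    ext1 i j
    simp
  · intro c l
    have h1 : shift (fun _ => (X : L[X])) = (X : L[X]) •
        (Polynomial.C : L →+* L[X]).mapMatrix ((finRotate (Module.finrank K L)).permMatrix L) := by
      ext1 i j
      rw [shift_apply, Matrix.smul_apply, RingHom.mapMatrix_apply, Matrix.map_apply,
        Equiv.Perm.permMatrix, PEquiv.toMatrix_apply]
      simp only [Equiv.toPEquiv_apply, Option.mem_some_iff, smul_eq_mul]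
      split_ifs <;> simp
    rw [map_mul, map_pow, rep_C, rep_x, h1, _root_.smul_pow, ← map_pow, mul_smul_comm, ← map_mul,
      coeff_C_mul_x_pow]
    ext1 i j
    rw [Matrix.map_apply, Matrix.smul_apply, RingHom.mapMatrix_apply, Matrix.map_apply, smul_eq_mul,
      coeff_X_pow_mul', Polynomial.coeff_C]
    by_cases hl : l = k
    · rw [if_pos hl, if_pos hl.le, if_pos (by omega), hl]
    · rw [if_neg hl, map_zero, zero_mul, Matrix.zero_apply]
      split_ifs with h2 h3
      · omega
      · rfl
      · rfl

/-- Over `L[u]` with `u ^ n = t`, the regular representation is conjugate to the homogeneous one,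
by the diagonal matrix `diag(u ^ (n - 1), …, u, 1)`. -/
theorem expand_reducedNorm (a : SkewRing σ) :
    expand L (Module.finrank K L) (reducedNorm σ a) = (homogeneousRep σ a).det := by
  set n := Module.finrank K L with hn
  have hn0 : 0 < n := Module.finrank_pos
  set S : Matrix (Fin n) (Fin n) L[X] := Matrix.diagonal fun i => X ^ (n - 1 - (i : ℕ)) with hS
  set e : Matrix (Fin n) (Fin n) L[X] →+* Matrix (Fin n) (Fin n) L[X] :=
    ((expand L n : L[X] →ₐ[L] L[X]) : L[X] →+* L[X]).mapMatrix with he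
  have key : S * e (regularRep σ a) = homogeneousRep σ a * S := by
    have hC : ∀ c, S * e (regularRep σ (C σ c)) = homogeneousRep σ (C σ c) * S := by
      intro c
      rw [rep_C, rep_C, he, hS, conjDiagonal_apply]
      simp only [RingHom.mapMatrix_apply, Matrix.diagonal_map (map_zero _),
        Matrix.diagonal_mul_diagonal]
      congr 1
      funext i
      change X ^ _ * expand L n (Polynomial.C _) = Polynomial.C _ * X ^ _
      rw [expand_C, mul_comm]
    have hx : S * e (regularRep σ (x σ)) = homogeneousRep σ (x σ) * S := by
      rw [rep_x, rep_x, he, hS]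
      ext1 i j
      rw [Matrix.diagonal_mul, Matrix.mul_diagonal, RingHom.mapMatrix_apply, Matrix.map_apply,
        shift_apply, shift_apply]
      by_cases h : finRotate _ i = j
      · rw [if_pos h, if_pos h, ← h]
        have hi := i.2
        rw [val_finRotate]
        split_ifs with h1
        · simp only [RingHom.coe_coe, expand_X]
          rw [← pow_add, ← pow_succ']
          congr 1
          omega
        · rw [map_one, mul_one, ← pow_succ']
          congr 1
          omega
      · rw [if_neg h, if_neg h, map_zero, mul_zero, zero_mul]
    refine induction σ (p := fun a => S * e (regularRep σ a) = homogeneousRep σ a * S) a ?_ ?_ ?_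
    · simp
    · intro a b ha hb
      rw [map_add, map_add, mul_add, ha, hb, map_add, add_mul]
    · intro c l
      have hx' : ∀ l : ℕ, S * e (regularRep σ (x σ ^ l)) = homogeneousRep σ (x σ ^ l) * S := by
        intro l
        induction l with
        | zero => simp
        | succ l ih =>
          rw [pow_succ, map_mul, map_mul, ← mul_assoc, ih, mul_assoc, hx, ← mul_assoc, ← map_mul]
      rw [map_mul, map_mul, ← mul_assoc, hC, mul_assoc, hx', ← mul_assoc, ← map_mul]
  have hdet := congrArg Matrix.det key
  rw [Matrix.det_mul, Matrix.det_mul, mul_comm] at hdet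
  have hS0 : S.det ≠ 0 := by
    rw [hS, Matrix.det_diagonal, Finset.prod_ne_zero_iff]
    exact fun i _ => pow_ne_zero _ X_ne_zero
  have h2 := mul_right_cancel₀ hS0 hdet
  rw [← h2, he, ← RingHom.map_det]
  rfl

variable {σ}

theorem orderOf_eq_finrank (hσ : ∀ τ : L ≃ₐ[K] L, τ ∈ Subgroup.zpowers σ) :
    orderOf σ = Module.finrank K L := by
  rw [orderOf_eq_card_of_forall_mem_zpowers hσ, IsGalois.card_aut_eq_finrank]

end rep

end SkewRing

namespace SkewRing

open Polynomial

variable {K L : Type*} [Field K] [Field L] [Algebra K L]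

section centralHom

variable (σ : L ≃ₐ[K] L)

/-- The substitution `F ↦ F(x ^ n)` as a ring homomorphism. -/
noncomputable def centralHom : K[X] →+* SkewRing σ :=
  Polynomial.eval₂RingHom' ((C σ).comp (algebraMap K L)) (x σ ^ Module.finrank K L)
    fun c => commute_C σ c _

theorem centralHom_apply (F : K[X]) : centralHom σ F = central σ F := rfl

@[simp] theorem central_C (c : K) : central σ (Polynomial.C c) = C σ (algebraMap K L c) :=
  Polynomial.eval₂_C _ _

@[simp] theorem central_X : central σ (X : K[X]) = x σ ^ Module.finrank K L :=
  Polynomial.eval₂_X _ _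

theorem central_mul (F G : K[X]) : central σ (F * G) = central σ F * central σ G :=
  map_mul (centralHom σ) F G

end centralHom

section reducedNorm

variable [FiniteDimensional K L] [IsGalois K L] {σ : L ≃ₐ[K] L}

/-- The powers `σ ^ i` with `i < n` are all the automorphisms of `L` over `K`. -/
theorem prod_pow_apply (hσ : ∀ τ : L ≃ₐ[K] L, τ ∈ Subgroup.zpowers σ) (c : L) :
    ∏ i : Fin (Module.finrank K L), (σ ^ (i : ℕ)) c = algebraMap K L (Algebra.norm K c) := by
  rw [Algebra.norm_eq_prod_automorphisms]
  refine Fintype.prod_bijective (fun i : Fin (Module.finrank K L) => σ ^ (i : ℕ)) ?_ _ _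
    fun _ => rfl
  rw [Fintype.bijective_iff_injective_and_card]
  constructor
  · intro i j h
    have ho := orderOf_eq_finrank hσ
    exact Fin.ext (pow_injOn_Iio_orderOf (by simp [ho]) (by simp [ho]) h)
  · rw [Fintype.card_fin, ← Nat.card_eq_fintype_card, IsGalois.card_aut_eq_finrank]

theorem det_conjDiagonal (hσ : ∀ τ : L ≃ₐ[K] L, τ ∈ Subgroup.zpowers σ) (c : L) :
    (conjDiagonal σ c).det = algebraMap K L (Algebra.norm K c) := by
  rw [conjDiagonal_apply, Matrix.det_diagonal, prod_pow_apply hσ]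

theorem natDegree_homogeneousRep_le (a : SkewRing σ) (i j : Fin (Module.finrank K L)) :
    (homogeneousRep σ a i j).natDegree ≤ a.natDegree := by
  refine Polynomial.natDegree_le_iff_coeff_eq_zero.2 fun k hk => ?_
  have h := coeff_homogeneousRep σ a k
  rw [coeff_eq_zero_of_natDegree_lt hk, map_zero, zero_mul] at h
  exact congrFun (congrFun h i) j

/-- The constant coefficient of the reduced norm is the norm of the constant coefficient. -/
theorem coeff_zero_reducedNorm (hσ : ∀ τ : L ≃ₐ[K] L, τ ∈ Subgroup.zpowers σ) (a : SkewRing σ) :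
    (reducedNorm σ a).coeff 0 = algebraMap K L (Algebra.norm K (a.coeff 0)) := by
  have h := congrArg (fun p => p.coeff 0) (expand_reducedNorm σ a)
  simp only [Matrix.coeff_zero_det, coeff_homogeneousRep, pow_zero, mul_one,
    det_conjDiagonal hσ] at h
  rw [← h, coeff_expand Module.finrank_pos, if_pos (dvd_zero _), Nat.zero_div]

theorem natDegree_reducedNorm_le (a : SkewRing σ) :
    (reducedNorm σ a).natDegree ≤ a.natDegree := by
  have h := Matrix.natDegree_det_le_of_natDegree_le _ _ (natDegree_homogeneousRep_le a)
  rw [← expand_reducedNorm, natDegree_expand, Fintype.card_fin, mul_comm] at h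
  exact Nat.le_of_mul_le_mul_left h Module.finrank_pos

/-- The coefficient of the reduced norm in degree `deg a` is, up to the sign of the cyclic
permutation, the norm of the leading coefficient. -/
theorem coeff_natDegree_reducedNorm (hσ : ∀ τ : L ≃ₐ[K] L, τ ∈ Subgroup.zpowers σ)
    (a : SkewRing σ) : (reducedNorm σ a).coeff a.natDegree =
      algebraMap K L ((-1) ^ (a.natDegree * (Module.finrank K L - 1)) *
        Algebra.norm K (a.coeff a.natDegree)) := by
  have h := Matrix.coeff_det_of_natDegree_le _ _ (natDegree_homogeneousRep_le a)
  rw [← expand_reducedNorm, Fintype.card_fin, mul_comm, coeff_expand_mul Module.finrank_pos,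
    coeff_homogeneousRep, Matrix.det_mul, Matrix.det_pow, Matrix.det_permutation, sign_finRotate,
    det_conjDiagonal hσ] at h
  rw [h, map_mul, mul_comm, mul_comm a.natDegree, pow_mul]
  simp

theorem natDegree_reducedNorm (hσ : ∀ τ : L ≃ₐ[K] L, τ ∈ Subgroup.zpowers σ) {a : SkewRing σ}
    (ha : a ≠ 0) :
    reducedNorm σ a ≠ 0 ∧ (reducedNorm σ a).natDegree = a.natDegree := by
  have h : (reducedNorm σ a).coeff a.natDegree ≠ 0 := by
    rw [coeff_natDegree_reducedNorm hσ, Ne, FaithfulSMul.algebraMap_eq_zero_iff]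
    refine mul_ne_zero (pow_ne_zero _ (neg_ne_zero.2 one_ne_zero)) ?_
    rw [Ne, Algebra.norm_eq_zero_iff]
    exact coeff_natDegree_ne_zero ha
  exact ⟨fun h0 => h (by rw [h0, Polynomial.coeff_zero]),
    (natDegree_reducedNorm_le a).antisymm (le_natDegree_of_ne_zero h)⟩

/-- In the homogeneous representation `x ^ n` acts as the scalar `u ^ n`, so `F(x ^ n)` acts as the
scalar `F(u ^ n)`. -/
theorem reducedNorm_central (F : K[X]) :
    reducedNorm σ (central σ F) = F.map (algebraMap K L) ^ Module.finrank K L := by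
  have h : (homogeneousRep σ).comp (centralHom σ) =
      (Matrix.scalar (Fin (Module.finrank K L))).comp
        (((expand L (Module.finrank K L) : L[X] →ₐ[L] L[X]) : L[X] →+* L[X]).comp
          (Polynomial.mapRingHom (algebraMap K L))) := by
    refine Polynomial.ringHom_ext (fun c => ?_) ?_
    · simp only [RingHom.comp_apply, centralHom_apply, central_C, rep_C, conjDiagonal_apply,
        AlgEquiv.commutes, RingHom.mapMatrix_apply, Matrix.diagonal_map (map_zero _),
        coe_mapRingHom, Polynomial.map_C, RingHom.coe_coe, expand_C, Matrix.scalar_apply]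
    · have h1 : shift (fun _ : Fin (Module.finrank K L) => (X : L[X])) =
          Matrix.scalar _ (X : L[X]) * (finRotate _).permMatrix L[X] := rfl
      have h2 : (finRotate (Module.finrank K L)).permMatrix L[X] ^ Module.finrank K L = 1 := by
        have h := map_pow (Matrix.permMatrixHom (R := L[X])) (finRotate (Module.finrank K L))⁻¹
          (Module.finrank K L)
        rw [inv_pow, finRotate_pow_self, inv_one, map_one] at h
        simpa using h.symm
      simp only [RingHom.comp_apply, centralHom_apply, central_X, map_pow, rep_x, h1,
        coe_mapRingHom, Polynomial.map_X, RingHom.coe_coe, expand_X]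
      rw [(Matrix.scalar_commute _ (Commute.all _) _).mul_pow, h2, mul_one]
  have h' := RingHom.congr_fun h F
  rw [RingHom.comp_apply, centralHom_apply] at h'
  apply expand_injective (R := L) (Module.finrank_pos (R := K) (M := L))
  rw [expand_reducedNorm, h', RingHom.comp_apply, Matrix.scalar_apply, Matrix.det_diagonal,
    Finset.prod_const, Finset.card_univ, Fintype.card_fin, map_pow]
  rfl

/-- Applying `σ` to all coefficients. -/
noncomputable def conj (σ : L ≃ₐ[K] L) : SkewRing σ →+* SkewRing σ :=
  lift ((C σ).comp (σ : L →+* L)) (x σ) (by exact fun c => x_mul_C σ (σ c))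

omit [FiniteDimensional K L] [IsGalois K L] in
@[simp] theorem conj_C (c : L) : conj σ (C σ c) = C σ (σ c) := lift_C _ _ _ c

omit [FiniteDimensional K L] [IsGalois K L] in
@[simp] theorem conj_x : conj σ (x σ) = x σ := lift_x _ _ _

omit [FiniteDimensional K L] [IsGalois K L] in
theorem x_mul (a : SkewRing σ) : x σ * a = conj σ a * x σ := by
  refine induction σ (p := fun a => x σ * a = conj σ a * x σ) a ?_ ?_ ?_
  · simp
  · intro a b ha hb
    rw [mul_add, ha, hb, map_add, add_mul]
  · intro c i
    rw [← mul_assoc, x_mul_C, map_mul, map_pow, conj_C, conj_x, mul_assoc, mul_assoc,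
      (Commute.self_pow (x σ) i).eq]

theorem regularRep_conj (a : SkewRing σ) :
    regularRep σ (conj σ a) =
      (Polynomial.mapRingHom (σ : L →+* L)).mapMatrix (regularRep σ a) := by
  have hC : ∀ c, regularRep σ (conj σ (C σ c)) =
      (Polynomial.mapRingHom (σ : L →+* L)).mapMatrix (regularRep σ (C σ c)) := by
    intro c
    rw [conj_C, rep_C, rep_C, conjDiagonal_apply, conjDiagonal_apply]
    simp only [RingHom.mapMatrix_apply, Matrix.diagonal_map (map_zero _)]
    congr 1
    funext i
    change Polynomial.C _ = Polynomial.map _ (Polynomial.C _)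
    rw [Polynomial.map_C]
    congr 1
    exact congrArg (fun τ : L ≃ₐ[K] L => τ c) ((Commute.self_pow σ (i : ℕ)).eq).symm
  have hx : regularRep σ (conj σ (x σ)) =
      (Polynomial.mapRingHom (σ : L →+* L)).mapMatrix (regularRep σ (x σ)) := by
    rw [conj_x, rep_x]
    ext1 i j
    rw [RingHom.mapMatrix_apply, Matrix.map_apply, shift_apply]
    split_ifs <;> simp
  refine induction σ (p := fun a => regularRep σ (conj σ a) =
    (Polynomial.mapRingHom (σ : L →+* L)).mapMatrix (regularRep σ a)) a ?_ ?_ ?_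
  · simp
  · intro a b ha hb
    rw [map_add, map_add, map_add, map_add, ha, hb]
  · intro c i
    rw [map_mul, map_mul, map_mul, map_mul, hC, map_pow, map_pow, map_pow, map_pow, hx]

theorem mem_range_algebraMap_of_fixed (hσ : ∀ τ : L ≃ₐ[K] L, τ ∈ Subgroup.zpowers σ) {c : L}
    (hc : σ c = c) : c ∈ Set.range (algebraMap K L) := by
  rw [IsGalois.mem_range_algebraMap_iff_fixed]
  intro τ
  have hs : Subgroup.zpowers σ ≤ MulAction.stabilizer (L ≃ₐ[K] L) c := by
    rw [Subgroup.zpowers_le]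
    exact hc
  exact hs (hσ τ)

/-- The reduced norm has coefficients in `K`: since `x a = a^σ x`, the reduced norms of `a` and of
its conjugate `a^σ` agree, so they are fixed by `σ`. -/
theorem exists_map_eq_reducedNorm (hσ : ∀ τ : L ≃ₐ[K] L, τ ∈ Subgroup.zpowers σ)
    (a : SkewRing σ) : ∃ p : K[X], p.map (algebraMap K L) = reducedNorm σ a := by
  have h1 : (reducedNorm σ a).map (σ : L →+* L) = reducedNorm σ a := by
    -- the nonzero reduced norm of `x` cancels in `Nrd(x) Nrd(a) = Nrd(a^σ) Nrd(x)`
    have h := congrArg (reducedNorm σ) (x_mul a)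
    rw [map_mul, map_mul, mul_comm, reducedNorm_apply σ (conj σ a), regularRep_conj,
      ← RingHom.map_det, ← reducedNorm_apply] at h
    have hx : reducedNorm σ (x σ) ≠ 0 := (natDegree_reducedNorm hσ x_ne_zero).1
    exact (mul_right_cancel₀ hx h).symm
  have h2 : reducedNorm σ a ∈ Polynomial.lifts (algebraMap K L) := by
    rw [Polynomial.lifts_iff_coeff_lifts]
    intro i
    have hi : σ ((reducedNorm σ a).coeff i) = (reducedNorm σ a).coeff i := by
      conv_rhs => rw [← h1, Polynomial.coeff_map]
      rfl
    exact mem_range_algebraMap_of_fixed hσ hi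
  exact (Polynomial.mem_lifts _).1 h2

end reducedNorm

end SkewRing

namespace SkewRing

open Polynomial

variable {K L : Type*} [Field K] [Field L] [Algebra K L]

/-! ### Degrees, units, and norms of divisors of `F(x ^ n)` -/

section degree

variable [FiniteDimensional K L] [IsGalois K L] {σ : L ≃ₐ[K] L}

theorem reducedNorm_zero (hσ : ∀ τ : L ≃ₐ[K] L, τ ∈ Subgroup.zpowers σ) :
    reducedNorm σ 0 = 0 := by
  have h1 := natDegree_reducedNorm_le (0 : SkewRing σ)
  have h2 : (0 : SkewRing σ).natDegree = 0 := Nat.le_zero.1 (natDegree_le fun _ _ => rfl)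
  rw [h2, Nat.le_zero] at h1
  rw [← leadingCoeff_eq_zero, leadingCoeff, h1, coeff_zero_reducedNorm hσ, coeff_zero,
    Algebra.norm_zero, map_zero]

theorem isDomain (hσ : ∀ τ : L ≃ₐ[K] L, τ ∈ Subgroup.zpowers σ) : IsDomain (SkewRing σ) :=
  haveI : NoZeroDivisors (SkewRing σ) := ⟨fun {a b} h => by
    by_contra! h0
    refine mul_ne_zero (natDegree_reducedNorm hσ h0.1).1 (natDegree_reducedNorm hσ h0.2).1 ?_
    rw [← map_mul, h, reducedNorm_zero hσ]⟩
  NoZeroDivisors.to_isDomain _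

theorem natDegree_mul (hσ : ∀ τ : L ≃ₐ[K] L, τ ∈ Subgroup.zpowers σ) {a b : SkewRing σ}
    (ha : a ≠ 0) (hb : b ≠ 0) : (a * b).natDegree = a.natDegree + b.natDegree := by
  have := isDomain hσ
  obtain ⟨ha', hda⟩ := natDegree_reducedNorm hσ ha
  obtain ⟨hb', hdb⟩ := natDegree_reducedNorm hσ hb
  rw [← (natDegree_reducedNorm hσ (mul_ne_zero ha hb)).2, map_mul,
    Polynomial.natDegree_mul ha' hb', hda, hdb]

/-- The units of `L[x; σ]` are the nonzero constants. -/
theorem isUnit_iff (hσ : ∀ τ : L ≃ₐ[K] L, τ ∈ Subgroup.zpowers σ) {a : SkewRing σ} (ha : a ≠ 0) :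
    IsUnit a ↔ a.natDegree = 0 := by
  constructor
  · rintro ⟨u, rfl⟩
    have h1 : (1 : SkewRing σ).natDegree = 0 := by
      have := natDegree_mul hσ (one_ne_zero (α := SkewRing σ)) one_ne_zero
      rw [mul_one] at this
      omega
    have := natDegree_mul hσ u.ne_zero u⁻¹.ne_zero
    rw [Units.mul_inv, h1] at this
    omega
  · intro h
    rw [eq_C_of_natDegree_eq_zero h]
    refine (IsUnit.mk0 _ fun h0 => ha ?_).map _
    rw [eq_C_of_natDegree_eq_zero h, h0, map_zero]

theorem central_ne_zero {F : K[X]} (hσ : ∀ τ : L ≃ₐ[K] L, τ ∈ Subgroup.zpowers σ) (hF : F ≠ 0) :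
    central σ F ≠ 0 := by
  intro h
  have h1 := reducedNorm_central (σ := σ) F
  rw [h, reducedNorm_zero hσ] at h1
  exact pow_ne_zero _ ((Polynomial.map_ne_zero_iff (algebraMap K L).injective).2 hF) h1.symm

theorem natDegree_central {F : K[X]} (hσ : ∀ τ : L ≃ₐ[K] L, τ ∈ Subgroup.zpowers σ) (hF : F ≠ 0) :
    (central σ F).natDegree = F.natDegree * Module.finrank K L := by
  rw [← (natDegree_reducedNorm hσ (central_ne_zero hσ hF)).2, reducedNorm_central,
    Polynomial.natDegree_pow, Polynomial.natDegree_map, mul_comm]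

/-- If the reduced norm of `a` is `F ^ j` up to a constant, comparison of the constant and leading
coefficients gives the norm of the constant coefficient of `a`. -/
theorem norm_coeff_zero_of_reducedNorm_eq (hσ : ∀ τ : L ≃ₐ[K] L, τ ∈ Subgroup.zpowers σ)
    {a : SkewRing σ} (ha : a ≠ 0) {F : K[X]} (hF : F.Monic) {γ : L} {j : ℕ}
    (h : reducedNorm σ a = Polynomial.C γ * F.map (algebraMap K L) ^ j) :
    a.natDegree = j * F.natDegree ∧
      Algebra.norm K (a.coeff 0) = (-1) ^ (a.natDegree * (Module.finrank K L - 1)) *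
        Algebra.norm K (a.coeff a.natDegree) * F.coeff 0 ^ j := by
  obtain ⟨h0, hd⟩ := natDegree_reducedNorm hσ ha
  have hm : (F.map (algebraMap K L) ^ j).Monic := (hF.map _).pow j
  have hγ : γ ≠ 0 := by
    rintro rfl
    rw [map_zero, zero_mul] at h
    exact h0 h
  have hd' : a.natDegree = j * F.natDegree := by
    rw [← hd, h, natDegree_C_mul hγ, Polynomial.natDegree_pow, Polynomial.natDegree_map]
  refine ⟨hd', ?_⟩
  have hlead : γ = algebraMap K L ((-1) ^ (a.natDegree * (Module.finrank K L - 1)) *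
      Algebra.norm K (a.coeff a.natDegree)) := by
    have e : a.natDegree = (F.map (algebraMap K L) ^ j).natDegree := by
      rw [hd', Polynomial.natDegree_pow, Polynomial.natDegree_map]
    rw [← coeff_natDegree_reducedNorm hσ, h, Polynomial.coeff_C_mul]
    conv_rhs => rw [e]
    rw [hm.coeff_natDegree, mul_one]
  apply (algebraMap K L).injective
  rw [← coeff_zero_reducedNorm hσ, h, Polynomial.coeff_C_mul, hlead, map_mul (algebraMap K L) _ (F.coeff 0 ^ j),
    coeff_zero_eq_eval_zero, eval_pow, ← coeff_zero_eq_eval_zero, Polynomial.coeff_map, map_pow]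

/-- The reduced norm of a divisor of `F(x ^ n)` divides `F ^ n` in `K[t]`, so it is a constant times
a power of the irreducible polynomial `F`. -/
theorem exists_reducedNorm_eq_of_mul_eq_central (hσ : ∀ τ : L ≃ₐ[K] L, τ ∈ Subgroup.zpowers σ)
    {F : K[X]} (hF : Irreducible F) {g h : SkewRing σ} (hgh : g * h = central σ F) :
    ∃ (j : ℕ) (γ : L), reducedNorm σ g = Polynomial.C γ * F.map (algebraMap K L) ^ j := by
  obtain ⟨p, hp⟩ := exists_map_eq_reducedNorm hσ g
  obtain ⟨q, hq⟩ := exists_map_eq_reducedNorm hσ h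
  have h1 : p * q = F ^ Module.finrank K L := by
    apply Polynomial.map_injective _ (algebraMap K L).injective
    rw [Polynomial.map_mul, Polynomial.map_pow, ← reducedNorm_central (σ := σ), ← hgh, map_mul, hp,
      hq]
  obtain ⟨j, -, u, hu⟩ := (dvd_prime_pow hF.prime _).1 (Dvd.intro _ h1)
  obtain ⟨c, -, hc⟩ := Polynomial.isUnit_iff.1 (u⁻¹).isUnit
  refine ⟨j, algebraMap K L c, ?_⟩
  have h2 : p = Polynomial.C c * F ^ j := by
    rw [hc, ← hu, mul_comm, mul_assoc, Units.mul_inv, mul_one]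
  rw [← hp, h2, Polynomial.map_mul, Polynomial.map_pow, Polynomial.map_C]

end degree

/-! ### Division with remainder -/

section division

variable {σ : L ≃ₐ[K] L}

/-- Division on the right: the remainder `r` has degree less than that of `g`. -/
theorem exists_eq_mul_add (a : SkewRing σ) {g : SkewRing σ} (hg : g ≠ 0) :
    ∃ q r, a = q * g + r ∧ ∀ i, g.natDegree ≤ i → r.coeff i = 0 := by
  have H : ∀ (N : ℕ) (a : SkewRing σ), (∀ i, g.natDegree + N ≤ i → a.coeff i = 0) →
      ∃ q r, a = q * g + r ∧ ∀ i, g.natDegree ≤ i → r.coeff i = 0 := by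
    intro N
    induction N with
    | zero => exact fun a ha => ⟨0, a, by simp, ha⟩
    | succ N ih =>
      intro a ha
      set e := g.natDegree with he
      have hge : (σ ^ N) (g.coeff e) ≠ 0 := by
        rw [Ne, map_eq_zero_iff _ (σ ^ N).injective]
        exact coeff_natDegree_ne_zero hg
      -- the leading coefficient of `c x ^ N g` is `c σ ^ N(g_e)`, so this `c` removes that of `a`
      set c := a.coeff (e + N) / (σ ^ N) (g.coeff e) with hc
      obtain ⟨q, r, h, hr⟩ := ih (a - C σ c * x σ ^ N * g) fun i hi => by
        rw [coeff_sub, mul_assoc, coeff_C_mul, coeff_x_pow_mul, if_pos (by omega)]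
        rcases hi.eq_or_lt with rfl | hi
        · rw [Nat.add_sub_cancel, hc, div_mul_cancel₀ _ hge, sub_self]
        · rw [ha i (by omega), coeff_eq_zero_of_natDegree_lt (a := g) (by omega)]
          simp
      exact ⟨q + C σ c * x σ ^ N, r, by rw [add_mul, add_right_comm, ← h]; abel, hr⟩
  exact H a.natDegree.succ a fun i hi => coeff_eq_zero_of_natDegree_lt (by omega)

/-- Division on the left: the remainder `r` has degree less than that of `g`. It is possible because
`σ` is surjective. -/
theorem exists_eq_mul_add' (a : SkewRing σ) {g : SkewRing σ} (hg : g ≠ 0) :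
    ∃ q r, a = g * q + r ∧ ∀ i, g.natDegree ≤ i → r.coeff i = 0 := by
  have H : ∀ (N : ℕ) (a : SkewRing σ), (∀ i, g.natDegree + N ≤ i → a.coeff i = 0) →
      ∃ q r, a = g * q + r ∧ ∀ i, g.natDegree ≤ i → r.coeff i = 0 := by
    intro N
    induction N with
    | zero => exact fun a ha => ⟨0, a, by simp, ha⟩
    | succ N ih =>
      intro a ha
      set e := g.natDegree with he
      have hge : g.coeff e ≠ 0 := coeff_natDegree_ne_zero hg
      -- the leading coefficient of `g c x ^ N` is `g_e σ ^ e(c)`, so this `c` removes that of `a`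
      set c := (σ ^ e).symm (a.coeff (e + N) / g.coeff e) with hc
      obtain ⟨q, r, h, hr⟩ := ih (a - g * (C σ c * x σ ^ N)) fun i hi => by
        rw [coeff_sub, ← mul_assoc, coeff_mul_x_pow, if_pos (by omega), coeff_mul_C]
        rcases hi.eq_or_lt with rfl | hi
        · rw [Nat.add_sub_cancel, hc, AlgEquiv.apply_symm_apply, mul_div_cancel₀ _ hge, sub_self]
        · rw [ha i (by omega), coeff_eq_zero_of_natDegree_lt (a := g) (by omega)]
          simp
      exact ⟨q + C σ c * x σ ^ N, r, by rw [mul_add, add_right_comm, ← h]; abel, hr⟩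
  exact H a.natDegree.succ a fun i hi => coeff_eq_zero_of_natDegree_lt (by omega)

/-- A nonzero left ideal has a nonzero element of least degree, and division with remainder shows
that it is generated by it. -/
theorem exists_span_eq {I : Ideal (SkewRing σ)} (hI : I ≠ ⊥) :
    ∃ g ≠ 0, g ∈ I ∧ (∀ b ∈ I, (∀ i, g.natDegree ≤ i → b.coeff i = 0) → b = 0) ∧
      I = Ideal.span {g} := by
  obtain ⟨b, hb, hb0⟩ := Submodule.exists_mem_ne_zero_of_ne_bot hI
  obtain ⟨g, ⟨hgI, hg0⟩, hmin⟩ := WellFounded.has_min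
    (InvImage.wf (natDegree (σ := σ)) Nat.lt_wfRel.wf) {g | g ∈ I ∧ g ≠ 0} ⟨b, hb, hb0⟩
  have hsmall : ∀ b ∈ I, (∀ i, g.natDegree ≤ i → b.coeff i = 0) → b = 0 := by
    intro b hb h
    by_contra h0
    exact hmin b ⟨hb, h0⟩ (natDegree_lt h0 h)
  refine ⟨g, hg0, hgI, hsmall, le_antisymm (fun a ha => ?_) ?_⟩
  · obtain ⟨q, r, h, hr⟩ := exists_eq_mul_add a hg0
    have hr0 : r = 0 := hsmall r (by
      rw [← sub_eq_iff_eq_add'.2 h]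
      exact I.sub_mem ha (I.mul_mem_left _ hgI)) hr
    rw [h, hr0, add_zero]
    exact Ideal.mem_span_singleton'.2 ⟨q, rfl⟩
  · rwa [Ideal.span_singleton_le_iff_mem]

/-- The greatest common left divisor `g` of `a` and `b`, with `a R + b R = g R`. -/
theorem exists_gcd_left (a : SkewRing σ) {b : SkewRing σ} (hb : b ≠ 0) :
    ∃ g ≠ 0, (∃ u v, g = a * u + b * v) ∧ (∃ c, a = g * c) ∧ ∃ h, b = g * h := by
  obtain ⟨g, ⟨⟨u, v, hg⟩, hg0⟩, hmin⟩ := WellFounded.has_min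
    (InvImage.wf (natDegree (σ := σ)) Nat.lt_wfRel.wf) {g | (∃ u v, g = a * u + b * v) ∧ g ≠ 0}
    ⟨b, ⟨0, 1, by simp⟩, hb⟩
  have hdiv : ∀ u' v', ∃ c, a * u' + b * v' = g * c := by
    intro u' v'
    obtain ⟨q, r, h, hr⟩ := exists_eq_mul_add' (a * u' + b * v') hg0
    have hr0 : r = 0 := by
      by_contra h0
      refine hmin r ⟨⟨u' - u * q, v' - v * q, ?_⟩, h0⟩ (natDegree_lt h0 hr)
      rw [← sub_eq_iff_eq_add'.2 h, hg]
      noncomm_ring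
    exact ⟨q, by rw [h, hr0, add_zero]⟩
  exact ⟨g, hg0, ⟨u, v, hg⟩, by simpa using hdiv 1 0, by simpa using hdiv 0 1⟩

/-- If the skew polynomials of degree less than `d` are representatives of the classes of a
quotient of `L[x; σ]`, this quotient has dimension `n d` over `K`. -/
theorem finrank_eq_of_representatives [FiniteDimensional K L] {V : Type*} [AddCommGroup V]
    [Module K V] (π : SkewRing σ →ₗ[K] V) (hπ : Function.Surjective π) (d : ℕ)
    (h1 : ∀ a, ∃ r, π a = π r ∧ ∀ i, d ≤ i → r.coeff i = 0)
    (h2 : ∀ r, (∀ i, d ≤ i → r.coeff i = 0) → π r = 0 → r = 0) :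
    Module.Finite K V ∧ Module.finrank K V = Module.finrank K L * d := by
  let f : (Fin d → L) →ₗ[K] SkewRing σ :=
    { toFun := fun c => ∑ i, C σ (c i) * x σ ^ (i : ℕ)
      map_add' := fun a b => by simp [add_mul, Finset.sum_add_distrib]
      map_smul' := fun k a => by
        simp only [Pi.smul_apply, Algebra.smul_def, map_mul, RingHom.id_apply, mul_assoc,
          Finset.mul_sum, algebraMap_eq_C] }
  have hf : ∀ c j, (f c).coeff j = if h : j < d then c ⟨j, h⟩ else 0 := by
    intro c j
    change (∑ i, C σ (c i) * x σ ^ (i : ℕ)).coeff j = _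
    rw [coeff_sum]
    simp only [coeff_C_mul_x_pow]
    split_ifs with h
    · rw [Finset.sum_eq_single ⟨j, h⟩ (fun i _ hi => if_neg fun e => hi (Fin.ext e))
        (fun h => (h (Finset.mem_univ _)).elim), if_pos rfl]
    · exact Finset.sum_eq_zero fun i _ => if_neg fun e => h (lt_of_eq_of_lt e.symm i.2)
  have hbij : Function.Bijective (π ∘ₗ f) := by
    constructor
    · rw [← LinearMap.ker_eq_bot, LinearMap.ker_eq_bot']
      intro c hc
      have h0 := h2 (f c) (fun i hi => by rw [hf, dif_neg (by omega)]) hc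
      funext i
      have := hf c i
      rw [h0, dif_pos i.2, coeff_zero] at this
      exact this.symm
    · intro v
      obtain ⟨a, rfl⟩ := hπ v
      obtain ⟨r, hr, hrd⟩ := h1 a
      refine ⟨fun i => r.coeff i, ?_⟩
      rw [hr]
      refine congrArg π (ext fun j => ?_)
      rw [hf]
      split_ifs with h
      · rfl
      · exact (hrd j (by omega)).symm
  let e := LinearEquiv.ofBijective _ hbij
  refine ⟨Module.Finite.equiv e, ?_⟩
  rw [← e.finrank_eq, Module.finrank_pi_fintype]
  simp [mul_comm]

end division

end SkewRing

namespace SkewRing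

open Polynomial

variable {K L : Type*} [Field K] [Field L] [Algebra K L] [FiniteDimensional K L] [IsGalois K L]
  {σ : L ≃ₐ[K] L}

/-! ### Two-sided ideals containing `F(x ^ n)` -/

omit [FiniteDimensional K L] [IsGalois K L] in
/-- A skew polynomial without constant coefficient is left divisible by `x`. -/
theorem exists_eq_x_mul {b : SkewRing σ} (hb : b.coeff 0 = 0) :
    ∃ q, b = x σ * q ∧ ∀ i, σ (q.coeff i) = b.coeff (i + 1) := by
  obtain ⟨q, r, h, hr⟩ := exists_eq_mul_add' b x_ne_zero
  rw [natDegree_x] at hr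
  have hr0 : r = 0 := ext fun i => by
    rcases Nat.eq_zero_or_pos i with rfl | hi
    · rw [h, coeff_add, coeff_x_mul_zero, zero_add] at hb
      exact hb
    · exact hr i hi
  rw [hr0, add_zero] at h
  exact ⟨q, h, fun i => by rw [h, coeff_x_mul_succ]⟩

omit [IsGalois K L] in
/-- If `F(0) ≠ 0`, then `x` is invertible modulo `F(x ^ n)`. -/
theorem mem_of_x_mul_mem {F : K[X]} (h0 : F.coeff 0 ≠ 0) {I : Ideal (SkewRing σ)}
    (hI : I.IsTwoSided) (hFI : central σ F ∈ I) {b : SkewRing σ} (hb : x σ * b ∈ I) : b ∈ I := by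
  have h : central σ F = central σ F.divX * x σ ^ Module.finrank K L +
      C σ (algebraMap K L (F.coeff 0)) := by
    conv_lhs => rw [← divX_mul_X_add F]
    rw [← centralHom_apply, map_add, map_mul, centralHom_apply, centralHom_apply, centralHom_apply,
      central_X, central_C]
  have h1 : C σ (algebraMap K L (F.coeff 0)) * b ∈ I := by
    have e : C σ (algebraMap K L (F.coeff 0)) * b =
        central σ F * b - central σ F.divX * x σ ^ (Module.finrank K L - 1) * (x σ * b) := by
      rw [h, ← mul_assoc _ (x σ) b, mul_assoc _ _ (x σ), ← pow_succ,
        Nat.sub_add_cancel Module.finrank_pos, add_mul, add_sub_cancel_left]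
    rw [e]
    exact I.sub_mem (I.mul_mem_right _ hFI) (I.mul_mem_left _ hb)
  have h2 := I.mul_mem_left (C σ (algebraMap K L (F.coeff 0))⁻¹) h1
  rwa [← mul_assoc, ← map_mul, inv_mul_cancel₀, map_one, one_mul] at h2
  simpa using h0

/-- A skew polynomial whose nonzero coefficients all lie in `K` and occur in degrees
divisible by `n` is central. -/
theorem exists_central_eq (hσ : ∀ τ : L ≃ₐ[K] L, τ ∈ Subgroup.zpowers σ) {g : SkewRing σ}
    (h1 : ∀ i, σ (g.coeff i) = g.coeff i) (h2 : ∀ i, g.coeff i ≠ 0 → Module.finrank K L ∣ i) :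
    ∃ G : K[X], central σ G = g := by
  choose κ hκ using fun i => mem_range_algebraMap_of_fixed hσ (h1 i)
  set n := Module.finrank K L with hn
  have hn0 : 0 < n := Module.finrank_pos
  refine ⟨∑ j ∈ Finset.range (g.natDegree + 1), Polynomial.C (κ (n * j)) * X ^ j, ext fun i => ?_⟩
  rw [← centralHom_apply, map_sum, coeff_sum]
  simp only [map_mul, map_pow, centralHom_apply, central_C, central_X, hκ, ← hn, ← pow_mul,
    coeff_C_mul_x_pow]
  by_cases hi : n ∣ i
  · obtain ⟨j, rfl⟩ := hi
    have e : ∀ k, (if n * k = n * j then g.coeff (n * k) else 0) =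
        if k = j then g.coeff (n * j) else 0 := by
      intro k
      by_cases hk : k = j
      · rw [if_pos hk, hk, if_pos rfl]
      · rw [if_neg hk, if_neg fun h => hk (Nat.eq_of_mul_eq_mul_left hn0 h)]
    rw [Finset.sum_congr rfl fun k _ => e k, Finset.sum_ite_eq']
    simp only [Finset.mem_range]
    split_ifs with hj
    · rfl
    · refine (coeff_eq_zero_of_natDegree_lt (a := g) ?_).symm
      nlinarith
  · rw [Finset.sum_eq_zero fun k _ => if_neg fun h => hi ⟨k, h.symm⟩]
    by_contra h
    exact hi (h2 i (Ne.symm h))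

/-- `R / R F(x ^ n)` is a simple ring when `F` is irreducible and `F(0) ≠ 0`: a monic element of
least degree of a two-sided ideal commutes with `x` and with `L` up to elements of smaller degree,
so it is central. -/
theorem eq_top_or_eq_span_central (hσ : ∀ τ : L ≃ₐ[K] L, τ ∈ Subgroup.zpowers σ) {F : K[X]}
    (hF : Irreducible F) (h0 : F.coeff 0 ≠ 0) {I : Ideal (SkewRing σ)} (hI : I.IsTwoSided)
    (hFI : central σ F ∈ I) : I = ⊤ ∨ I = Ideal.span {central σ F} := by
  have hbot : I ≠ ⊥ := by
    rintro rfl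
    exact central_ne_zero hσ hF.ne_zero hFI
  obtain ⟨g₁, hg₁, hg₁I, hsmall, hspan⟩ := exists_span_eq hbot
  set d := g₁.natDegree with hd
  have hlead : g₁.coeff d ≠ 0 := coeff_natDegree_ne_zero hg₁
  -- `g` is a monic element of least degree of `I`
  set g := C σ (g₁.coeff d)⁻¹ * g₁ with hg
  have hgI : g ∈ I := I.mul_mem_left _ hg₁I
  have hgd : g.coeff d = 1 := by rw [hg, coeff_C_mul, inv_mul_cancel₀ hlead]
  have hgt : ∀ i, d < i → g.coeff i = 0 := fun i hi => by
    rw [hg, coeff_C_mul, coeff_eq_zero_of_natDegree_lt (a := g₁) (i := i) (by omega), mul_zero]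
  have hx : ∀ q, x σ * q ∈ I → (∀ i, d ≤ i → σ (q.coeff i) = 0) → q = 0 := fun q hq h =>
    hsmall q (mem_of_x_mul_mem h0 hI hFI hq) fun i hi =>
      (map_eq_zero_iff σ σ.injective).1 (h i hi)
  -- otherwise `g` divided by `x` would be an element of smaller degree
  have hg0 : g.coeff 0 ≠ 0 := by
    intro h
    obtain ⟨q, hq, hqi⟩ := exists_eq_x_mul h
    have : q = 0 := hx q (hq ▸ hgI) fun i hi => by rw [hqi, hgt _ (by omega)]
    rw [hq, this, mul_zero, coeff_zero] at hgd
    exact zero_ne_one hgd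
  -- `x g - g x` has degree at most `d` and is divisible by `x`, with a quotient in `I` of degree less
  -- than `d`, so it vanishes
  have hfix : ∀ i, σ (g.coeff i) = g.coeff i := by
    have hc : ∀ i, (x σ * g - g * x σ).coeff (i + 1) = σ (g.coeff i) - g.coeff i := fun i => by
      rw [coeff_sub, coeff_x_mul_succ, coeff_mul_x_succ]
    have hc0 : (x σ * g - g * x σ).coeff 0 = 0 := by
      rw [coeff_sub, coeff_x_mul_zero, coeff_mul_x_zero, sub_zero]
    obtain ⟨q, hq, hqi⟩ := exists_eq_x_mul hc0
    have hq0 : q = 0 := by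
      refine hx q (hq ▸ I.sub_mem (I.mul_mem_left _ hgI) (I.mul_mem_right _ hgI)) fun i hi => ?_
      rw [hqi, hc]
      rcases hi.eq_or_lt with rfl | hi
      · rw [hgd, map_one, sub_self]
      · rw [hgt i hi, map_zero, sub_self]
    intro i
    have := hqi i
    rw [hc, hq0, coeff_zero, map_zero] at this
    exact (sub_eq_zero.1 this.symm)
  -- `σ ^ d(b) g - g b` is an element of `I` of degree less than `d`, so it vanishes
  have hcomm : ∀ (b : L) (i : ℕ), (σ ^ d) b * g.coeff i - g.coeff i * (σ ^ i) b = 0 := by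
    intro b i
    have hz : C σ ((σ ^ d) b) * g - g * C σ b = 0 := by
      refine hsmall _ (I.sub_mem (I.mul_mem_left _ hgI) (I.mul_mem_right _ hgI)) fun i hi => ?_
      rw [coeff_sub, coeff_C_mul, coeff_mul_C]
      rcases hi.eq_or_lt with rfl | hi
      · rw [hgd, mul_one, one_mul, sub_self]
      · rw [hgt i hi, mul_zero, zero_mul, sub_self]
    have := congrArg (fun a => SkewRing.coeff a i) hz
    simpa using this
  -- `g_0 ≠ 0` gives `σ ^ d = 1`, and then `σ ^ i = 1` in every degree `i` that occurs in `g`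
  have hpow : ∀ i, g.coeff i ≠ 0 → σ ^ i = σ ^ d := by
    intro i hi
    refine AlgEquiv.ext fun b => ?_
    have := hcomm b i
    rw [mul_comm, ← mul_sub] at this
    exact (sub_eq_zero.1 ((mul_eq_zero.1 this).resolve_left hi)).symm
  have hdvd : ∀ i, g.coeff i ≠ 0 → Module.finrank K L ∣ i := by
    intro i hi
    rw [← orderOf_eq_finrank hσ, orderOf_dvd_iff_pow_eq_one, hpow i hi, ← hpow 0 hg0, pow_zero]
  obtain ⟨G, hG⟩ := exists_central_eq hσ hfix hdvd
  have hg₁g : g₁ = C σ (g₁.coeff d) * g := by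
    rw [hg, ← mul_assoc, ← map_mul, mul_inv_cancel₀ hlead, map_one, one_mul]
  -- `g = G(x ^ n)`, where `G` is a multiple of `F` or coprime to it
  rcases (dvd_or_isCoprime F G hF) with ⟨H, rfl⟩ | ⟨u, v, huv⟩
  · right
    refine le_antisymm ?_ ((Ideal.span_singleton_le_iff_mem _).2 hFI)
    rw [hspan, Ideal.span_singleton_le_iff_mem, hg₁g, ← hG, mul_comm F, central_mul, ← mul_assoc]
    exact Ideal.mem_span_singleton'.2 ⟨_, rfl⟩
  · left
    rw [Ideal.eq_top_iff_one]
    have h1 := congrArg (centralHom σ) huv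
    rw [map_one, map_add, map_mul, map_mul, centralHom_apply σ F, centralHom_apply σ G, hG] at h1
    rw [← h1]
    exact I.add_mem (I.mul_mem_left _ hFI) (I.mul_mem_left _ hgI)

/-! ### Simple modules and irreducible factors -/

/-- As `F(x ^ n)` is central, its left divisors and its right divisors are the same. -/
theorem mul_eq_central_comm (hσ : ∀ τ : L ≃ₐ[K] L, τ ∈ Subgroup.zpowers σ) {F : K[X]} (hF : F ≠ 0)
    {a b : SkewRing σ} (h : a * b = central σ F) : b * a = central σ F := by
  have := isDomain hσ
  have ha : a ≠ 0 := by
    rintro rfl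
    rw [zero_mul] at h
    exact central_ne_zero hσ hF h.symm
  refine mul_left_cancel₀ ha ?_
  rw [← mul_assoc, h, (commute_central σ F a).eq]

theorem isSimpleModule_quotient (hσ : ∀ τ : L ≃ₐ[K] L, τ ∈ Subgroup.zpowers σ) {f : SkewRing σ}
    (hf : Irreducible f) :
    IsSimpleModule (SkewRing σ) (SkewRing σ ⧸ (Ideal.span {f} : Ideal (SkewRing σ))) := by
  have hf0 : f ≠ 0 := hf.ne_zero
  rw [isSimpleModule_iff_isCoatom]
  refine ⟨fun h => ?_, fun J hJ => ?_⟩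
  · obtain ⟨u, hu⟩ := Ideal.mem_span_singleton'.1 ((Ideal.eq_top_iff_one _).1 h)
    have hu0 : u ≠ 0 := by
      rintro rfl
      rw [zero_mul] at hu
      exact zero_ne_one hu
    refine hf.not_isUnit ((isUnit_iff hσ hf0).2 ?_)
    have h1 := natDegree_mul hσ hu0 hf0
    rw [hu, (isUnit_iff hσ one_ne_zero).1 isUnit_one] at h1
    omega
  · have hbot : J ≠ ⊥ := (bot_le.trans_lt hJ).ne'
    obtain ⟨g, -, -, -, rfl⟩ := exists_span_eq hbot
    obtain ⟨u, hu⟩ := Ideal.mem_span_singleton'.1 (hJ.le (Ideal.mem_span_singleton_self f))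
    rcases hf.isUnit_or_isUnit hu.symm with h | ⟨v, rfl⟩
    · obtain ⟨v, rfl⟩ := h
      refine (hJ.not_ge ((Ideal.span_singleton_le_iff_mem _).2 ?_)).elim
      exact Ideal.mem_span_singleton'.2 ⟨((v⁻¹ : (SkewRing σ)ˣ) : SkewRing σ), by
        rw [← hu, ← mul_assoc, Units.inv_mul, one_mul]⟩
    · rw [Ideal.eq_top_iff_one]
      exact Ideal.mem_span_singleton'.2 ⟨((v⁻¹ : (SkewRing σ)ˣ) : SkewRing σ), Units.inv_mul v⟩

omit [IsGalois K L] in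
/-- The skew polynomials of degree less than `deg f` represent the classes of `R / R f`, which hence
has dimension `n deg f` over `K`. -/
theorem finrank_quotient_span {f : SkewRing σ} (hf : f ≠ 0)
    (hsmall : ∀ r ∈ Ideal.span {f}, (∀ i, f.natDegree ≤ i → r.coeff i = 0) → r = 0) :
    Module.Finite K (SkewRing σ ⧸ (Ideal.span {f} : Ideal (SkewRing σ))) ∧
      Module.finrank K (SkewRing σ ⧸ (Ideal.span {f} : Ideal (SkewRing σ))) =
        Module.finrank K L * f.natDegree := by
  let π : SkewRing σ →ₗ[K] (SkewRing σ ⧸ (Ideal.span {f} : Ideal (SkewRing σ))) :=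
    (Submodule.mkQ (Ideal.span {f} : Ideal (SkewRing σ))).restrictScalars K
  have hπ : Function.Surjective π :=
    Submodule.mkQ_surjective (Ideal.span {f} : Ideal (SkewRing σ))
  have h1 : ∀ a, ∃ r, π a = π r ∧ ∀ i, f.natDegree ≤ i → r.coeff i = 0 := by
    intro a
    obtain ⟨q, r, h, hr⟩ := exists_eq_mul_add a hf
    refine ⟨r, ?_, hr⟩
    refine (Submodule.Quotient.eq _).2 ?_
    rw [h, add_sub_cancel_right]
    exact Ideal.mem_span_singleton'.2 ⟨q, rfl⟩
  have h2 : ∀ r, (∀ i, f.natDegree ≤ i → r.coeff i = 0) → π r = 0 → r = 0 :=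
    fun r hr h => hsmall r ((Submodule.Quotient.mk_eq_zero _).1 h) hr
  exact finrank_eq_of_representatives π hπ f.natDegree h1 h2

theorem eq_zero_of_mem_span (hσ : ∀ τ : L ≃ₐ[K] L, τ ∈ Subgroup.zpowers σ) {f : SkewRing σ}
    (hf : f ≠ 0) {r : SkewRing σ} (hr : r ∈ Ideal.span {f})
    (h : ∀ i, f.natDegree ≤ i → r.coeff i = 0) : r = 0 := by
  obtain ⟨u, rfl⟩ := Ideal.mem_span_singleton'.1 hr
  by_contra h0
  have hu : u ≠ 0 := fun hu => h0 (by rw [hu, zero_mul])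
  refine coeff_natDegree_ne_zero h0 (h _ ?_)
  rw [natDegree_mul hσ hu hf]
  omega

/-- All irreducible divisors of `F(x ^ n)` give isomorphic simple modules, as `R / R F(x ^ n)` is a
simple ring. -/
theorem nonempty_linearEquiv_quotient (hσ : ∀ τ : L ≃ₐ[K] L, τ ∈ Subgroup.zpowers σ) {F : K[X]}
    (hF : Irreducible F) (h0 : F.coeff 0 ≠ 0) {f q : SkewRing σ} (hf : Irreducible f)
    (hq : Irreducible q) (hfF : f ∣ central σ F) (hqF : q ∣ central σ F) :
    Nonempty ((SkewRing σ ⧸ (Ideal.span {q} : Ideal (SkewRing σ))) ≃ₗ[SkewRing σ]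
      (SkewRing σ ⧸ (Ideal.span {f} : Ideal (SkewRing σ)))) := by
  have := isSimpleModule_quotient hσ hf
  have := isSimpleModule_quotient hσ hq
  obtain ⟨v, hv⟩ := hfF
  obtain ⟨w, hw⟩ := hqF
  have hFf : ∀ b, central σ F * b ∈ (Ideal.span {f} : Ideal (SkewRing σ)) := fun b => by
    rw [(commute_central σ F b).eq, ← mul_eq_central_comm hσ hF.ne_zero hv.symm, ← mul_assoc]
    exact Ideal.mem_span_singleton'.2 ⟨_, rfl⟩
  set S := SkewRing σ ⧸ (Ideal.span {f} : Ideal (SkewRing σ))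
  have hann : Module.annihilator (SkewRing σ) S = Ideal.span {central σ F} := by
    refine (eq_top_or_eq_span_central hσ hF h0 inferInstance ?_).resolve_left fun h => ?_
    · rw [Module.mem_annihilator]
      intro m
      obtain ⟨b, rfl⟩ := Submodule.mkQ_surjective _ m
      rw [← map_smul]
      exact (Submodule.Quotient.mk_eq_zero _).2 (hFf b)
    · have := IsSimpleModule.nontrivial (SkewRing σ) S
      exact not_subsingleton S (Module.annihilator_eq_top_iff.1 h)
  -- `F(x ^ n) = q w`, and `w` does not annihilate `R / R f`: for `w m ≠ 0` the map `r ↦ r w m`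
  -- vanishes on `R q` and gives a nonzero map from `R / R q` to `R / R f`
  have hw0 : w ≠ 0 := by
    rintro rfl
    rw [mul_zero] at hw
    exact central_ne_zero hσ hF.ne_zero hw
  have hwF : w ∉ Module.annihilator (SkewRing σ) S := by
    intro h
    rw [hann] at h
    refine hw0 (eq_zero_of_mem_span hσ (central_ne_zero hσ hF.ne_zero) h fun i hi => ?_)
    refine coeff_eq_zero_of_natDegree_lt ?_
    have hq1 : q.natDegree ≠ 0 := fun h => hq.not_isUnit ((isUnit_iff hσ hq.ne_zero).2 h)
    have := natDegree_mul hσ hq.ne_zero hw0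
    rw [← hw] at this
    omega
  rw [Module.mem_annihilator] at hwF
  push Not at hwF
  obtain ⟨m, hm⟩ := hwF
  obtain ⟨b, rfl⟩ := Submodule.mkQ_surjective _ m
  let φ : (SkewRing σ ⧸ (Ideal.span {q} : Ideal (SkewRing σ))) →ₗ[SkewRing σ] S :=
    Submodule.liftQ _ (LinearMap.toSpanSingleton (SkewRing σ) S
      (w • Submodule.mkQ (Ideal.span {f} : Ideal (SkewRing σ)) b)) (by
      rw [Submodule.span_singleton_le_iff_mem, LinearMap.mem_ker, LinearMap.toSpanSingleton_apply,
        ← map_smul, ← map_smul, smul_eq_mul, smul_eq_mul, ← mul_assoc, ← hw]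
      exact (Submodule.Quotient.mk_eq_zero _).2 (hFf b))
  have hφ : φ ≠ 0 := fun h => hm (by
    have := LinearMap.congr_fun h (Submodule.mkQ _ 1)
    simpa [φ] using this)
  exact ⟨LinearEquiv.ofBijective φ (LinearMap.bijective_of_ne_zero hφ)⟩

theorem natDegree_eq_of_dvd_central (hσ : ∀ τ : L ≃ₐ[K] L, τ ∈ Subgroup.zpowers σ) {F : K[X]}
    (hF : Irreducible F) (h0 : F.coeff 0 ≠ 0) {f q : SkewRing σ} (hf : Irreducible f)
    (hq : Irreducible q) (hfF : f ∣ central σ F) (hqF : q ∣ central σ F) :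
    q.natDegree = f.natDegree := by
  obtain ⟨e⟩ := nonempty_linearEquiv_quotient hσ hF h0 hf hq hfF hqF
  have h := (e.restrictScalars K).finrank_eq
  rw [(finrank_quotient_span hf.ne_zero fun r hr h => eq_zero_of_mem_span hσ hf.ne_zero hr h).2,
    (finrank_quotient_span hq.ne_zero fun r hr h => eq_zero_of_mem_span hσ hq.ne_zero hr h).2] at h
  exact Nat.eq_of_mul_eq_mul_left Module.finrank_pos h

theorem dvd_central_of_mem (hσ : ∀ τ : L ≃ₐ[K] L, τ ∈ Subgroup.zpowers σ) {F : K[X]} (hF : F ≠ 0)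
    {l : List (SkewRing σ)} (hl : l.prod = central σ F) {q : SkewRing σ} (hq : q ∈ l) :
    q ∣ central σ F := by
  obtain ⟨l₁, l₂, rfl⟩ := List.append_of_mem hq
  rw [List.prod_append, List.prod_cons] at hl
  have := mul_eq_central_comm hσ hF hl
  exact ⟨_, by rw [← mul_assoc, this]⟩

theorem natDegree_list_prod (hσ : ∀ τ : L ≃ₐ[K] L, τ ∈ Subgroup.zpowers σ) {δ : ℕ}
    (l : List (SkewRing σ)) (h0 : ∀ q ∈ l, q ≠ 0) (hl : ∀ q ∈ l, q.natDegree = δ) :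
    l.prod.natDegree = l.length * δ := by
  have := isDomain hσ
  induction l with
  | nil => rw [List.prod_nil, (isUnit_iff hσ one_ne_zero).1 isUnit_one, List.length_nil, zero_mul]
  | cons q l ih =>
    rw [List.forall_mem_cons] at h0 hl
    rw [List.prod_cons, natDegree_mul hσ h0.1 (List.prod_ne_zero fun h => h0.2 0 h rfl), hl.1,
      ih h0.2 hl.2, List.length_cons]
    ring

/-- The irreducible factors of `F(x ^ n)` all have degree `s n / m`. For `F = y` this holds because
they are associated to `x`. -/
theorem length_mul_natDegree (hσ : ∀ τ : L ≃ₐ[K] L, τ ∈ Subgroup.zpowers σ) {F : K[X]}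
    (hFm : F.Monic) (hF : Irreducible F) {m : ℕ} (hm : IsProductOfIrreducibles (central σ F) m)
    {f : SkewRing σ} (hf : Irreducible f) (hfF : f ∣ central σ F) :
    m * f.natDegree = F.natDegree * Module.finrank K L := by
  obtain ⟨l, rfl, hirr, hl⟩ := hm
  have hdeg : ∀ q ∈ l, q.natDegree = f.natDegree := by
    by_cases h0 : F.coeff 0 = 0
    · -- the norm formula gives `N(q_0) = 0`, so that `q` is divisible by `x`
      have h1 : ∀ q : SkewRing σ, Irreducible q → q ∣ central σ F → q.natDegree = 1 := by
        intro q hq hqF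
        obtain ⟨w, hw⟩ := hqF
        obtain ⟨j, γ, hj⟩ := exists_reducedNorm_eq_of_mul_eq_central hσ hF hw.symm
        obtain ⟨hd, hn⟩ := norm_coeff_zero_of_reducedNorm_eq hσ hq.ne_zero hFm hj
        have hj0 : j ≠ 0 := by
          rintro rfl
          rw [zero_mul] at hd
          exact hq.not_isUnit ((isUnit_iff hσ hq.ne_zero).2 hd)
        rw [h0, zero_pow hj0, mul_zero, Algebra.norm_eq_zero_iff] at hn
        obtain ⟨q', rfl, -⟩ := exists_eq_x_mul hn
        have hq0 : q' ≠ 0 := right_ne_zero_of_mul hq.ne_zero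
        have hu := (hq.isUnit_or_isUnit rfl).resolve_left fun h => by
          rw [isUnit_iff hσ x_ne_zero, natDegree_x] at h
          omega
        rw [natDegree_mul hσ x_ne_zero hq0, natDegree_x, (isUnit_iff hσ hq0).1 hu]
      intro q hq
      rw [h1 q (hirr q hq) (dvd_central_of_mem hσ hF.ne_zero hl hq), h1 f hf hfF]
    · exact fun q hq => natDegree_eq_of_dvd_central hσ hF h0 hf (hirr q hq) hfF
        (dvd_central_of_mem hσ hF.ne_zero hl hq)
  rw [← natDegree_list_prod hσ l (fun q hq => (hirr q hq).ne_zero) hdeg, hl,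
    natDegree_central hσ hF.ne_zero]

theorem exists_irreducible_dvd_central (hσ : ∀ τ : L ≃ₐ[K] L, τ ∈ Subgroup.zpowers σ) {F : K[X]}
    (hF : Irreducible F) {m : ℕ} (hm : IsProductOfIrreducibles (central σ F) m) :
    ∃ f : SkewRing σ, Irreducible f ∧ f ∣ central σ F := by
  obtain ⟨l, -, hirr, hl⟩ := hm
  cases l with
  | nil =>
    have h := natDegree_central hσ hF.ne_zero
    rw [← hl, List.prod_nil, (isUnit_iff hσ one_ne_zero).1 isUnit_one] at h
    have := Nat.mul_pos hF.natDegree_pos (Module.finrank_pos (R := K) (M := L))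
    omega
  | cons q l => exact ⟨q, hirr q (by simp), _, by rw [← hl, List.prod_cons]⟩

/-- The degree of an irreducible divisor `f` of `F(x ^ n)` is `j s`, where `F ^ j` is its reduced norm
up to a constant, and `m deg f = s n` gives `m j = n`. -/
theorem dvd_finrank_and_natDegree_eq (hσ : ∀ τ : L ≃ₐ[K] L, τ ∈ Subgroup.zpowers σ) {F : K[X]}
    (hFm : F.Monic) (hF : Irreducible F) {m : ℕ} (hm : IsProductOfIrreducibles (central σ F) m) :
    m ∣ Module.finrank K L ∧ ∀ f : SkewRing σ, Irreducible f → f ∣ central σ F →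
      f.natDegree = F.natDegree * (Module.finrank K L / m) := by
  have key : ∀ f : SkewRing σ, Irreducible f → f ∣ central σ F →
      ∃ j, f.natDegree = j * F.natDegree ∧ m * j = Module.finrank K L := by
    intro f hf hfF
    have h1 := length_mul_natDegree hσ hFm hF hm hf hfF
    obtain ⟨w, hw⟩ := hfF
    obtain ⟨j, γ, hj⟩ := exists_reducedNorm_eq_of_mul_eq_central hσ hF hw.symm
    have hd := (norm_coeff_zero_of_reducedNorm_eq hσ hf.ne_zero hFm hj).1
    refine ⟨j, hd, Nat.eq_of_mul_eq_mul_left hF.natDegree_pos ?_⟩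
    rw [← h1, hd]
    ring
  obtain ⟨f, hf, hfF⟩ := exists_irreducible_dvd_central hσ hF hm
  obtain ⟨j, -, hj⟩ := key f hf hfF
  refine ⟨⟨j, hj.symm⟩, fun f hf hfF => ?_⟩
  obtain ⟨j, hd, hj⟩ := key f hf hfF
  have hm0 : 0 < m := by
    rcases Nat.eq_zero_or_pos m with rfl | h
    · have := Module.finrank_pos (R := K) (M := L)
      omega
    · exact h
  rw [hd, ← hj, Nat.mul_div_cancel_left _ hm0, mul_comm]

end SkewRing

/-! ### The rank of a matrix over a division ring -/

section Rank

open Module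

variable {K A D : Type*} [Field K] [Ring A] [Algebra K A] [DivisionRing D] {m : ℕ}

/-- The `K`-vector space structure on row vectors carried over from a `K`-algebra `A` by a ring
isomorphism of `A` with a matrix ring, which need not respect any given action of `K` on `D`:
a scalar acts by right multiplication with the corresponding matrix. -/
@[reducible] def rowModule (φ : A ≃+* Matrix (Fin m) (Fin m) D) : Module K (Fin m → D) where
  smul c v := Matrix.vecMul v (φ (algebraMap K A c))
  one_smul v := by
    change Matrix.vecMul v (φ (algebraMap K A 1)) = v
    rw [map_one, map_one, Matrix.vecMul_one]
  mul_smul c d v := by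
    change Matrix.vecMul v (φ (algebraMap K A (c * d))) =
      Matrix.vecMul (Matrix.vecMul v (φ (algebraMap K A d))) (φ (algebraMap K A c))
    rw [mul_comm, map_mul, map_mul, Matrix.vecMul_vecMul]
  smul_zero c := Matrix.zero_vecMul _
  smul_add c v w := Matrix.add_vecMul _ _ _
  add_smul c d v := by
    change Matrix.vecMul v (φ (algebraMap K A (c + d))) =
      Matrix.vecMul v (φ (algebraMap K A c)) + Matrix.vecMul v (φ (algebraMap K A d))
    rw [map_add, map_add, Matrix.vecMul_add]
  zero_smul v := by
    change Matrix.vecMul v (φ (algebraMap K A 0)) = 0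
    rw [map_zero, map_zero, Matrix.vecMul_zero]

theorem Matrix.mul_apply_col_eq_sum_smul {r : ℕ} (B : Matrix (Fin m) (Fin r) D)
    (Y : Matrix (Fin r) (Fin m) D) (j : Fin m) :
    (B * Y).col j = ∑ k, MulOpposite.op (Y k j) • B.col k := by
  funext i
  simp [Matrix.mul_apply, Matrix.col]

theorem Matrix.mul_of_col_eq_sum_smul {r : ℕ} (B : Matrix (Fin m) (Fin r) D)
    (c : Fin m → Fin r → Dᵐᵒᵖ) (j : Fin m) :
    (B * Matrix.of fun k j => (c j k).unop).col j = ∑ k, c j k • B.col k :=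
  Matrix.mul_apply_col_eq_sum_smul B _ j

/-- In `M_m(D)` the right ideal generated by `X` consists of the matrices with columns in the
column space of `X`; for a matrix `B` whose columns are a basis of this space it is `B · D^{r × m}`,
where `r` is the rank of `X`. -/
theorem exists_injective_range_eq (X : Matrix (Fin m) (Fin m) D) :
    ∃ B : Matrix (Fin m) (Fin (matrixRank X)) D,
      (∀ Y : Matrix (Fin (matrixRank X)) (Fin m) D, B * Y = 0 → Y = 0) ∧
      (∀ Y : Matrix (Fin (matrixRank X)) (Fin m) D, ∃ Z : Matrix (Fin m) (Fin m) D, B * Y = X * Z) ∧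
      ∀ Z : Matrix (Fin m) (Fin m) D, ∃ Y : Matrix (Fin (matrixRank X)) (Fin m) D, X * Z = B * Y := by
  set W := Submodule.span Dᵐᵒᵖ (Set.range X.col)
  have : FiniteDimensional Dᵐᵒᵖ W := FiniteDimensional.span_of_finite _ (Set.finite_range _)
  let b : Basis (Fin (matrixRank X)) Dᵐᵒᵖ W := Module.finBasis Dᵐᵒᵖ W
  let B : Matrix (Fin m) (Fin (matrixRank X)) D := fun i k => (b k : Fin m → D) i
  refine ⟨B, fun Y hY => ?_, fun Y => ?_, fun Z => ?_⟩
  · ext k j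
    have h : ∑ k, MulOpposite.op (Y k j) • b k = 0 := by
      apply Subtype.ext
      have := Matrix.mul_apply_col_eq_sum_smul B Y j
      rw [hY] at this
      push_cast
      exact this.symm
    have := Fintype.linearIndependent_iff.1 b.linearIndependent _ h k
    simpa using this
  · have h : ∀ j, ∃ c : Fin m → Dᵐᵒᵖ, ∑ i, c i • X.col i = (B * Y).col j := by
      intro j
      rw [← Submodule.mem_span_range_iff_exists_fun, Matrix.mul_apply_col_eq_sum_smul]
      exact Submodule.sum_mem _ fun k _ => Submodule.smul_mem _ _ (b k).2
    choose c hc using h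
    refine ⟨Matrix.of fun i j => (c j i).unop, ?_⟩
    ext i j
    exact congrFun ((hc j).symm.trans (Matrix.mul_of_col_eq_sum_smul X c j).symm) i
  · have h : ∀ j, (X * Z).col j ∈ W := by
      intro j
      rw [Matrix.mul_apply_col_eq_sum_smul]
      exact Submodule.sum_mem _ fun k _ =>
        Submodule.smul_mem _ _ (Submodule.subset_span (Set.mem_range_self k))
    refine ⟨Matrix.of fun k j => (b.repr ⟨_, h j⟩ k).unop, ?_⟩
    ext i j
    have := congrArg (Subtype.val) (b.sum_repr ⟨_, h j⟩)
    push_cast at this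
    exact congrFun (this.symm.trans (Matrix.mul_of_col_eq_sum_smul B (fun j => b.repr ⟨_, h j⟩) j).symm) i

theorem finrank_fin_fun_mul (V : Type*) [AddCommGroup V] [Module K V] (r : ℕ) :
    finrank K (Fin r → V) = r * finrank K V := by
  rw [finrank, rank_pi, Cardinal.sum_const, Cardinal.toNat_mul]
  simp [finrank]

/-- The `K`-dimension of `a A` is proportional to the rank of the matrix of `a`. The isomorphism `φ`
is only a ring isomorphism. -/
theorem mul_finrank_range_mulLeft (φ : A ≃+* Matrix (Fin m) (Fin m) D) (a : A) :
    m * finrank K (LinearMap.range (LinearMap.mulLeft K a)) =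
      matrixRank (φ a) * finrank K A := by
  let : Module K (Fin m → D) := rowModule φ
  have hsmul : ∀ {r : ℕ} (c : K) (Y : Fin r → Fin m → D),
      (Matrix.of (c • Y) : Matrix (Fin r) (Fin m) D) = Matrix.of Y * φ (algebraMap K A c) :=
    fun c Y => rfl
  -- `Y ↦ φ⁻¹(B Y)` is `K`-linear: on both sides the scalars act by right multiplication
  let Ψ : ∀ {r : ℕ}, Matrix (Fin m) (Fin r) D → (Fin r → Fin m → D) →ₗ[K] A := fun {r} B =>
    { toFun := fun Y => φ.symm (B * Matrix.of Y)
      map_add' := fun Y Z => by rw [← Matrix.of_add_of, Matrix.mul_add, map_add]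
      map_smul' := fun c Y => by
        rw [hsmul, ← Matrix.mul_assoc, map_mul, RingEquiv.symm_apply_apply, RingHom.id_apply,
          Algebra.smul_def, Algebra.commutes] }
  -- `B = 1` identifies `A` with the `m`-tuples of rows
  have h1 : finrank K A = m * finrank K (Fin m → D) := by
    have hbij : Function.Bijective (Ψ (1 : Matrix (Fin m) (Fin m) D)) := by
      constructor
      · intro Y Z h
        have h := φ.symm.injective h
        rw [Matrix.one_mul, Matrix.one_mul] at h
        exact Matrix.of.injective h
      · intro z
        refine ⟨fun k j => φ z k j, ?_⟩
        change φ.symm (1 * φ z) = z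
        rw [one_mul, RingEquiv.symm_apply_apply]
    rw [← (LinearEquiv.ofBijective _ hbij).finrank_eq, finrank_fin_fun_mul]
  obtain ⟨B, hB1, hB2, hB3⟩ := exists_injective_range_eq (φ a)
  -- a basis `B` of the column space of `φ a` identifies `a A` with the tuples of `matrixRank (φ a)` rows
  have h2 : finrank K (LinearMap.range (LinearMap.mulLeft K a)) =
      matrixRank (φ a) * finrank K (Fin m → D) := by
    have hinj : Function.Injective (Ψ B) := by
      rw [← LinearMap.ker_eq_bot, LinearMap.ker_eq_bot']
      intro Y hY
      exact Matrix.of.injective (hB1 _ ((map_eq_zero_iff φ.symm φ.symm.injective).1 hY))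
    have hrange : LinearMap.range (LinearMap.mulLeft K a) = LinearMap.range (Ψ B) := by
      refine le_antisymm ?_ ?_
      · rintro _ ⟨z, rfl⟩
        obtain ⟨Y, hY⟩ := hB3 (φ z)
        refine ⟨fun k j => Y k j, ?_⟩
        change φ.symm (B * Y) = a * z
        rw [← hY, map_mul, RingEquiv.symm_apply_apply, RingEquiv.symm_apply_apply]
      · rintro _ ⟨Y, rfl⟩
        obtain ⟨Z, hZ⟩ := hB2 (Matrix.of Y)
        exact ⟨φ.symm Z, by simp [Ψ, hZ]⟩
    rw [hrange, LinearMap.finrank_range_of_inj hinj, finrank_fin_fun_mul]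
  rw [h1, h2]
  ring

end Rank

theorem IsDivRing.mul_finrank_range_mulLeft {K A D : Type*} [Field K] [Ring A] [Algebra K A]
    [Ring D] (hD : IsDivRing D) {m : ℕ} (φ : A ≃+* Matrix (Fin m) (Fin m) D) (a : A) :
    m * Module.finrank K (LinearMap.range (LinearMap.mulLeft K a)) =
      matrixRank (φ a) * Module.finrank K A := by
  have := hD.1
  let : DivisionRing D := DivisionRing.ofIsUnitOrEqZero fun x =>
    (em (x = 0)).symm.imp_left (hD.2 x)
  exact _root_.mul_finrank_range_mulLeft φ a

/-! ### Eigenrings as endomorphism rings -/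

section Eigenring

open MulOpposite

variable {R : Type*} [Ring R]

/-- The endomorphism `r + R f ↦ r g + R f` of `R / R f` attached to an element `g` of the
idealiser of `f`. -/
def rightMulEnd {f : R} (g : leftIdealizer f) :
    Module.End R (R ⧸ (Ideal.span {f} : Ideal R)) :=
  Submodule.mapQ _ _ (LinearMap.toSpanSingleton R R (g : R))
    ((Submodule.span_singleton_le_iff_mem _ _).2 g.2)

theorem rightMulEnd_mk {f : R} (g : leftIdealizer f) (r : R) :
    rightMulEnd g (Submodule.Quotient.mk r) = Submodule.Quotient.mk (r * g) := rfl

/-- An endomorphism of a cyclic module is determined by the image of the generator. -/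
theorem endomorphism_ext {I : Ideal R} {α β : Module.End R (R ⧸ I)}
    (h : α (Submodule.Quotient.mk 1) = β (Submodule.Quotient.mk 1)) : α = β :=
  Submodule.linearMap_qext _ (LinearMap.ext_ring h)

/-- The eigenring of `f` is the opposite of the endomorphism ring of `R / R f`. -/
noncomputable def eigenringEquiv (f : R) :
    Eigenring f ≃+* (Module.End R (R ⧸ (Ideal.span {f} : Ideal R)))ᵐᵒᵖ :=
  RingEquiv.ofBijective
    (Ideal.Quotient.lift (idealInIdealizer f)
      { toFun := fun g => op (rightMulEnd g)
        map_one' := congrArg op (endomorphism_ext (by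
          rw [rightMulEnd_mk, Subring.coe_one, mul_one]; rfl))
        map_zero' := congrArg op (endomorphism_ext (by
          rw [rightMulEnd_mk, Subring.coe_zero, mul_zero]; rfl))
        map_add' := fun g h => congrArg op (endomorphism_ext (by
          rw [rightMulEnd_mk, Subring.coe_add, mul_add]; rfl))
        map_mul' := fun g h => congrArg op (endomorphism_ext (by
          rw [rightMulEnd_mk, Subring.coe_mul, ← mul_assoc]; rfl)) }
      (fun g hg => congrArg op (endomorphism_ext (by
        rw [rightMulEnd_mk, one_mul]
        exact (Submodule.Quotient.mk_eq_zero _).2 hg))))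
    (by
      constructor
      · rw [injective_iff_map_eq_zero]
        intro q hq
        obtain ⟨g, rfl⟩ := Ideal.Quotient.mk_surjective q
        rw [Ideal.Quotient.eq_zero_iff_mem]
        have h : rightMulEnd g = 0 := op_injective hq
        have h1 := LinearMap.congr_fun h (Submodule.Quotient.mk 1)
        rw [rightMulEnd_mk, one_mul] at h1
        exact (Submodule.Quotient.mk_eq_zero (Ideal.span {f} : Ideal R)).1 h1
      · intro α
        obtain ⟨g, hg⟩ := Submodule.Quotient.mk_surjective _ (α.unop (Submodule.Quotient.mk 1))
        have hgI : g ∈ leftIdealizer f := by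
          rw [mem_leftIdealizer, ← Submodule.Quotient.mk_eq_zero, ← smul_eq_mul,
            Submodule.Quotient.mk_smul, hg, ← map_smul, ← Submodule.Quotient.mk_smul, smul_eq_mul,
            mul_one, (Submodule.Quotient.mk_eq_zero _).2 (Ideal.mem_span_singleton_self f), map_zero]
        refine ⟨Ideal.Quotient.mk _ ⟨g, hgI⟩, unop_injective (endomorphism_ext ?_)⟩
        change rightMulEnd _ _ = _
        rw [rightMulEnd_mk, one_mul, hg])

theorem eigenringEquiv_centerToEigenring (f : R) (c : Subring.center R)
    (s : R ⧸ (Ideal.span {f} : Ideal R)) :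
    (eigenringEquiv f (centerToEigenring f c)).unop s = (c : R) • s := by
  obtain ⟨r, rfl⟩ := Submodule.Quotient.mk_surjective _ s
  change rightMulEnd _ _ = _
  rw [rightMulEnd_mk, ← Submodule.Quotient.mk_smul, smul_eq_mul,
    ← Subring.mem_center_iff.1 c.2 r]
  rfl

/-- Schur's lemma for the simple module `R / R f`. -/
theorem isDivRing_eigenring {f : R}
    (h : IsSimpleModule R (R ⧸ (Ideal.span {f} : Ideal R))) : IsDivRing (Eigenring f) := by
  classical
  have := IsSimpleModule.nontrivial R (R ⧸ (Ideal.span {f} : Ideal R))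
  refine ⟨(eigenringEquiv f).symm.injective.nontrivial, fun a ha => ?_⟩
  rw [← MulEquiv.isUnit_map (eigenringEquiv f)]
  exact IsUnit.mk0 (eigenringEquiv f a) fun h =>
    ha ((eigenringEquiv f).injective (h.trans (map_zero _).symm))

/-- A quotient ring of `R` is the opposite of its endomorphism ring as an `R`-module. -/
noncomputable def quotientEquivEnd (I : Ideal R) [I.IsTwoSided] :
    (R ⧸ I) ≃+* (Module.End R (R ⧸ I))ᵐᵒᵖ where
  toFun a := op
    { toFun := fun b => b * a
      map_add' := fun b c => add_mul b c a
      map_smul' := fun r b => by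
        obtain ⟨b, rfl⟩ := Ideal.Quotient.mk_surjective b
        exact mul_assoc (Ideal.Quotient.mk I r) (Ideal.Quotient.mk I b) a }
  invFun α := α.unop (Submodule.Quotient.mk 1)
  left_inv a := one_mul a
  right_inv α := unop_injective (endomorphism_ext (one_mul (α.unop (Submodule.Quotient.mk 1))))
  map_add' a b := congrArg op (LinearMap.ext fun c => mul_add c a b)
  map_mul' a b := congrArg op (LinearMap.ext fun c => (mul_assoc c a b).symm)

/-- If `R / I` is a direct sum of `k` copies of `R / R f`, then it is a matrix ring over the
eigenring of `f`. -/
noncomputable def matrixEquiv (I : Ideal R) [I.IsTwoSided] (f : R) {k : ℕ}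
    (e : (R ⧸ I) ≃ₗ[R] (Fin k → R ⧸ (Ideal.span {f} : Ideal R))) :
    (R ⧸ I) ≃+* Matrix (Fin k) (Fin k) (Eigenring f) :=
  (quotientEquivEnd I).trans <| (RingEquiv.op e.conjRingEquiv).trans <|
    (RingEquiv.op (endVecRingEquivMatrixEnd (Fin k) R _)).trans <|
      (RingEquiv.mopMatrix.symm).trans (eigenringEquiv f).symm.mapMatrix

theorem matrixEquiv_center (I : Ideal R) [I.IsTwoSided] (f : R) {k : ℕ}
    (e : (R ⧸ I) ≃ₗ[R] (Fin k → R ⧸ (Ideal.span {f} : Ideal R))) (c : Subring.center R) :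
    matrixEquiv I f e (Ideal.Quotient.mk I c) =
      Matrix.diagonal fun _ => centerToEigenring f c := by
  have hc : ∀ b : R ⧸ I, b * Ideal.Quotient.mk I c = (c : R) • b := by
    intro b
    obtain ⟨b, rfl⟩ := Ideal.Quotient.mk_surjective b
    rw [← map_mul, Subring.mem_center_iff.1 c.2 b]
    rfl
  ext i j
  change (eigenringEquiv f).symm (op _) = _
  rw [RingEquiv.symm_apply_eq]
  refine unop_injective (LinearMap.ext fun s => ?_)
  change e (e.symm (Pi.single i s) * Ideal.Quotient.mk I c) j = _
  rw [hc, map_smul, LinearEquiv.apply_symm_apply, Pi.smul_apply, Matrix.diagonal_apply]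
  by_cases h : i = j
  · rw [if_pos h, h, Pi.single_eq_same, eigenringEquiv_centerToEigenring]
  · rw [if_neg h, Pi.single_eq_of_ne' h, map_zero, smul_zero]
    rfl

end Eigenring

namespace SkewRing

open Polynomial

variable {K L : Type*} [Field K] [Field L] [Algebra K L] [FiniteDimensional K L] [IsGalois K L]
  {σ : L ≃ₐ[K] L}

/-! ### The structure of `R / R F(x ^ n)` -/

/-- `R / R F(x ^ n)` is a direct sum of copies of `R / R f`: the `R / R f`-isotypic component is
a nonzero two-sided ideal of a simple ring. -/
theorem exists_linearEquiv_fun (hσ : ∀ τ : L ≃ₐ[K] L, τ ∈ Subgroup.zpowers σ) {F : K[X]}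
    (hF : Irreducible F) (h0 : F.coeff 0 ≠ 0) {f : SkewRing σ} (hf : Irreducible f)
    (hfF : f ∣ central σ F) :
    ∃ k : ℕ, Nonempty (RF σ F ≃ₗ[SkewRing σ]
      (Fin k → SkewRing σ ⧸ (Ideal.span {f} : Ideal (SkewRing σ)))) := by
  have := isSimpleModule_quotient hσ hf
  obtain ⟨v, hv⟩ := hfF
  have hv0 : v ≠ 0 := by
    rintro rfl
    rw [mul_zero] at hv
    exact central_ne_zero hσ hF.ne_zero hv
  set S := SkewRing σ ⧸ (Ideal.span {f} : Ideal (SkewRing σ))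
  set Z := isotypicComponent (SkewRing σ) (RF σ F) S
  let J : Ideal (SkewRing σ) := Z.comap (Submodule.mkQ (Ideal.span {central σ F}))
  -- right multiplications are endomorphisms, and these preserve the isotypic component
  have hJ : J.IsTwoSided := ⟨fun {a} b ha =>
    Submodule.IsFullyInvariant.isotypicComponent (SkewRing σ) (RF σ F) S
      (quotientEquivEnd _ (toRF σ F b)).unop ha⟩
  have hFJ : central σ F ∈ J := by
    change Submodule.mkQ _ _ ∈ Z
    rw [Submodule.mkQ_apply, (Submodule.Quotient.mk_eq_zero _).2 (Ideal.mem_span_singleton_self _)]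
    exact Z.zero_mem
  -- `J` contains the class of `v`, where `F(x ^ n) = f v`, because `r ↦ r v` embeds `R / R f`
  have hJtop : J = ⊤ := by
    refine (eq_top_or_eq_span_central hσ hF h0 hJ hFJ).resolve_right fun h => ?_
    have hvF : v ∉ (Ideal.span {central σ F} : Ideal (SkewRing σ)) := fun hmem => by
      refine hv0 (eq_zero_of_mem_span hσ (central_ne_zero hσ hF.ne_zero) hmem fun i hi => ?_)
      refine coeff_eq_zero_of_natDegree_lt ?_
      have hf1 : f.natDegree ≠ 0 := fun h => hf.not_isUnit ((isUnit_iff hσ hf.ne_zero).2 h)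
      have := natDegree_mul hσ hf.ne_zero hv0
      rw [← hv] at this
      omega
    let φ : S →ₗ[SkewRing σ] RF σ F :=
      Submodule.liftQ _ (LinearMap.toSpanSingleton (SkewRing σ) (RF σ F)
        (Submodule.mkQ (Ideal.span {central σ F} : Ideal (SkewRing σ)) v)) (by
        rw [Submodule.span_singleton_le_iff_mem, LinearMap.mem_ker,
          LinearMap.toSpanSingleton_apply, ← map_smul, smul_eq_mul, ← hv]
        exact (Submodule.Quotient.mk_eq_zero _).2 (Ideal.mem_span_singleton_self _))
    have hφ1 : φ (Submodule.Quotient.mk 1) = Submodule.Quotient.mk v := by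
      change (1 : SkewRing σ) •
        Submodule.mkQ (Ideal.span {central σ F} : Ideal (SkewRing σ)) v = _
      rw [one_smul]
      rfl
    have hφ : Function.Injective φ := (LinearMap.injective_or_eq_zero φ).resolve_right fun h0 => by
      rw [h0, LinearMap.zero_apply] at hφ1
      exact hvF ((Submodule.Quotient.mk_eq_zero _).1 hφ1.symm)
    have hrange : LinearMap.range φ ≤ Z :=
      le_sSup ⟨(LinearEquiv.ofInjective φ hφ).symm⟩
    have : v ∈ J := by
      change Submodule.mkQ _ v ∈ Z
      exact hrange ⟨_, hφ1⟩
    exact hvF (h ▸ this)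
  have htop : Z = ⊤ := by
    rw [eq_top_iff]
    rintro z -
    obtain ⟨a, rfl⟩ := Submodule.mkQ_surjective _ z
    have : a ∈ J := hJtop ▸ Submodule.mem_top
    exact this
  have hss : IsSemisimpleModule (SkewRing σ) Z := inferInstance
  have : IsSemisimpleModule (SkewRing σ) (RF σ F) :=
    IsSemisimpleModule.congr ((LinearEquiv.ofTop Z htop).symm)
  exact (IsIsotypicOfType.of_isotypicComponent_eq_top htop).linearEquiv_fun

/-- The `K`-dimension of `R / R F(x ^ n)` is `s n ^ 2`. -/
theorem finrank_RF (hσ : ∀ τ : L ≃ₐ[K] L, τ ∈ Subgroup.zpowers σ) {F : K[X]} (hF : F ≠ 0) :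
    Module.Finite K (RF σ F) ∧ Module.finrank K (RF σ F) =
      Module.finrank K L * (F.natDegree * Module.finrank K L) := by
  have h0 := central_ne_zero (σ := σ) hσ hF
  have h := finrank_quotient_span h0 fun r hr h => eq_zero_of_mem_span hσ h0 hr h
  rw [natDegree_central hσ hF] at h
  exact h

/-- The number of copies of `R / R f` in `R / R F(x ^ n)` is `m`, by comparison of dimensions over
`K`. -/
theorem exists_isCenterLinear (hσ : ∀ τ : L ≃ₐ[K] L, τ ∈ Subgroup.zpowers σ) {F : K[X]}
    (hFm : F.Monic) (hF : Irreducible F) (h0 : F.coeff 0 ≠ 0) {m : ℕ}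
    (hm : IsProductOfIrreducibles (central σ F) m) {f : SkewRing σ} (hf : Irreducible f)
    (hfF : f ∣ central σ F) :
    ∃ φ : RF σ F ≃+* Matrix (Fin m) (Fin m) (Eigenring f), IsCenterLinear σ φ := by
  obtain ⟨k, ⟨e⟩⟩ := exists_linearEquiv_fun hσ hF h0 hf hfF
  have hn := Module.finrank_pos (R := K) (M := L)
  have hk : k = m := by
    have h1 := (e.restrictScalars K).finrank_eq
    rw [finrank_fin_fun_mul, (finrank_quotient_span hf.ne_zero fun r hr h =>
      eq_zero_of_mem_span hσ hf.ne_zero hr h).2] at h1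
    rw [(finrank_RF hσ hF.ne_zero).2, ← length_mul_natDegree hσ hFm hF hm hf hfF, mul_left_comm k] at h1
    have h2 := Nat.eq_of_mul_eq_mul_left hn h1
    refine (Nat.eq_of_mul_eq_mul_right ?_ h2).symm
    exact Nat.pos_of_ne_zero fun h => hf.not_isUnit ((isUnit_iff hσ hf.ne_zero).2 h)
  subst hk
  exact ⟨matrixEquiv _ f e, fun c => matrixEquiv_center _ f e c⟩

/-- If `a R + F(x ^ n) R = g R`, then `(R / F(x ^ n)) / a (R / F(x ^ n))` has dimension `n deg g`. -/
theorem finrank_range_mulLeft_add (hσ : ∀ τ : L ≃ₐ[K] L, τ ∈ Subgroup.zpowers σ) {F : K[X]}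
    (hF : F ≠ 0) {a g u v c h : SkewRing σ} (hg0 : g ≠ 0) (hg : g = a * u + central σ F * v)
    (hc : a = g * c) (hh : central σ F = g * h) :
    Module.finrank K L * g.natDegree +
        Module.finrank K (LinearMap.range (LinearMap.mulLeft K (toRF σ F a))) =
      Module.finrank K L * (F.natDegree * Module.finrank K L) := by
  obtain ⟨hfin, hdim⟩ := finrank_RF hσ hF
  set W := LinearMap.range (LinearMap.mulLeft K (toRF σ F a))
  -- the right ideal generated by the class of `a` is the image of `g R`
  have hmem : ∀ b : SkewRing σ, toRF σ F b ∈ W ↔ ∃ z, b = g * z := by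
    intro b
    constructor
    · rintro ⟨y, hy⟩
      obtain ⟨y, rfl⟩ := Ideal.Quotient.mk_surjective y
      have hy : toRF σ F (a * y) = toRF σ F b := by
        rw [map_mul]
        exact hy
      obtain ⟨w, hw⟩ := Ideal.mem_span_singleton'.1 ((Ideal.Quotient.mk_eq_mk_iff_sub_mem _ _).1 hy)
      refine ⟨c * y - h * w, ?_⟩
      rw [← (commute_central σ F w).eq] at hw
      rw [mul_sub, ← mul_assoc, ← mul_assoc, ← hc, ← hh, hw, sub_sub_cancel]
    · rintro ⟨z, rfl⟩
      refine ⟨toRF σ F (u * z), ?_⟩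
      rw [LinearMap.mulLeft_apply, ← map_mul]
      refine (Ideal.Quotient.mk_eq_mk_iff_sub_mem _ _).2 ?_
      rw [hg, add_mul, mul_assoc a, sub_add_cancel_left, mul_assoc,
        (commute_central σ F _).eq]
      exact Ideal.neg_mem_iff _ |>.2 (Ideal.mem_span_singleton'.2 ⟨_, rfl⟩)
  let π₀ : SkewRing σ →ₗ[K] RF σ F :=
    (Submodule.mkQ (Ideal.span {central σ F} : Ideal (SkewRing σ))).restrictScalars K
  have hπ₀ : Function.Surjective π₀ :=
    Submodule.mkQ_surjective (Ideal.span {central σ F} : Ideal (SkewRing σ))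
  let π : SkewRing σ →ₗ[K] (RF σ F ⧸ W) := W.mkQ ∘ₗ π₀
  have hπ : Function.Surjective π := (Submodule.mkQ_surjective W).comp hπ₀
  have hker : ∀ b, π b = 0 ↔ ∃ z, b = g * z := fun b =>
    (Submodule.Quotient.mk_eq_zero W).trans (hmem b)
  have h1 : ∀ b, ∃ r, π b = π r ∧ ∀ i, g.natDegree ≤ i → r.coeff i = 0 := by
    intro b
    obtain ⟨q, r, hb, hr⟩ := exists_eq_mul_add' b hg0
    refine ⟨r, ?_, hr⟩
    rw [← sub_eq_zero, ← map_sub, hker]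
    exact ⟨q, by rw [hb, add_sub_cancel_right]⟩
  have h2 : ∀ r, (∀ i, g.natDegree ≤ i → r.coeff i = 0) → π r = 0 → r = 0 := by
    intro r hr h
    obtain ⟨z, rfl⟩ := (hker r).1 h
    by_contra hne
    have hz : z ≠ 0 := right_ne_zero_of_mul hne
    refine coeff_natDegree_ne_zero hne (hr _ ?_)
    rw [natDegree_mul hσ hg0 hz]
    omega
  rw [← (finrank_eq_of_representatives π hπ g.natDegree h1 h2).2, ← hdim]
  exact Submodule.finrank_quotient_add_finrank W

theorem coeff_zero_ne_zero_of_ne_X {F : K[X]} (hFm : F.Monic) (hF : Irreducible F) (hX : F ≠ X) :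
    F.coeff 0 ≠ 0 := by
  intro h
  refine hX (eq_of_monic_of_associated monic_X hFm ?_).symm
  exact irreducible_X.associated_of_dvd hF (X_dvd_iff.2 h)

/-- The greatest common left divisor of `a` and `F(x ^ n)` has degree `(m - r) s n / m`, where `r`
is the rank of `a`. -/
theorem exists_gcd_natDegree_eq (hσ : ∀ τ : L ≃ₐ[K] L, τ ∈ Subgroup.zpowers σ) {F : K[X]}
    (hFm : F.Monic) (hF : Irreducible F) {m : ℕ}
    (hm : IsProductOfIrreducibles (central σ F) m) {D : Type*} [Ring D] (hD : IsDivRing D)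
    (φ : RF σ F ≃+* Matrix (Fin m) (Fin m) D) (a : SkewRing σ) :
    ∃ g c h, a = g * c ∧ central σ F = g * h ∧ g.natDegree +
      F.natDegree * matrixRank (φ (toRF σ F a)) * (Module.finrank K L / m) =
      F.natDegree * m * (Module.finrank K L / m) := by
  obtain ⟨g, hg0, ⟨u, v, hg⟩, ⟨c, hc⟩, ⟨h, hh⟩⟩ :=
    exists_gcd_left a (central_ne_zero (σ := σ) hσ hF.ne_zero)
  refine ⟨g, c, h, hc, hh, ?_⟩
  have h1 := finrank_range_mulLeft_add hσ hF.ne_zero hg0 hg hc hh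
  have h2 := hD.mul_finrank_range_mulLeft (K := K) φ (toRF σ F a)
  obtain ⟨ℓ, hℓ⟩ := (dvd_finrank_and_natDegree_eq hσ hFm hF hm).1
  have hn := Module.finrank_pos (R := K) (M := L)
  rw [(finrank_RF hσ hF.ne_zero).2] at h2
  have hm0 : 0 < m := Nat.pos_of_ne_zero fun h => by
    rw [h, zero_mul] at hℓ
    omega
  have hℓ' : Module.finrank K L / m = ℓ := by rw [hℓ, Nat.mul_div_cancel_left _ hm0]
  rw [hℓ']
  set r := matrixRank (φ (toRF σ F a))
  set n := Module.finrank K L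
  set s := F.natDegree
  set w := Module.finrank K (LinearMap.range (LinearMap.mulLeft K (toRF σ F a)))
  apply Nat.eq_of_mul_eq_mul_left (Nat.mul_pos hm0 hn)
  calc m * n * (g.natDegree + s * r * ℓ) = m * (n * g.natDegree) + r * (n * (s * (m * ℓ))) := by ring
    _ = m * (n * g.natDegree + w) := by rw [← hℓ, ← h2]; ring
    _ = m * n * (s * m * ℓ) := by rw [h1, hℓ]; ring

/-! ### Bounds of irreducible polynomials -/

theorem central_mem_center (G : K[X]) : central σ G ∈ Subring.center (SkewRing σ) :=
  Subring.mem_center_iff.2 fun a => ((commute_central σ G a).eq).symm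

theorem dvd_central_of_annihilator_eq (hσ : ∀ τ : L ≃ₐ[K] L, τ ∈ Subgroup.zpowers σ) {F : K[X]}
    (hF : F ≠ 0) {f : SkewRing σ}
    (h : Module.annihilator (SkewRing σ) (SkewRing σ ⧸ (Ideal.span {f} : Ideal (SkewRing σ))) =
      Ideal.span {central σ F}) : f ∣ central σ F := by
  have h1 := Module.mem_annihilator.1 (h ▸ Ideal.mem_span_singleton_self (central σ F))
    (Submodule.Quotient.mk 1)
  rw [← Submodule.Quotient.mk_smul, smul_eq_mul, mul_one, Submodule.Quotient.mk_eq_zero] at h1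
  obtain ⟨u, hu⟩ := Ideal.mem_span_singleton'.1 h1
  exact ⟨u, (mul_eq_central_comm hσ hF hu).symm⟩

/-- If `F = G H`, then `G(x ^ n) H(x ^ n)` vanishes in the division ring `E(f)`, so one of the two
factors annihilates `R / R f`. -/
theorem irreducible_of_annihilator_eq (hσ : ∀ τ : L ≃ₐ[K] L, τ ∈ Subgroup.zpowers σ) {F : K[X]}
    (hFm : F.Monic) {f : SkewRing σ} (hf : Irreducible f)
    (h : Module.annihilator (SkewRing σ) (SkewRing σ ⧸ (Ideal.span {f} : Ideal (SkewRing σ))) =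
      Ideal.span {central σ F}) : Irreducible F := by
  have hS := isSimpleModule_quotient hσ hf
  have hD := isDivRing_eigenring hS
  have hn := Module.finrank_pos (R := K) (M := L)
  -- if `G(x ^ n)` vanishes in `E(f)`, it annihilates `R / R f`, whence `deg F ≤ deg G`
  have hcent : ∀ G : K[X], centerToEigenring f ⟨central σ G, central_mem_center G⟩ = 0 ↔
      central σ G ∈ (Ideal.span {f} : Ideal (SkewRing σ)) := fun G =>
    Ideal.Quotient.eq_zero_iff_mem
  have hdeg : ∀ G : K[X], G ≠ 0 → central σ G ∈ (Ideal.span {f} : Ideal (SkewRing σ)) →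
      F.natDegree ≤ G.natDegree := by
    intro G hG hmem
    have h1 : central σ G ∈ (Ideal.span {central σ F} : Ideal (SkewRing σ)) := by
      rw [← h, Module.mem_annihilator]
      intro s
      obtain ⟨r, rfl⟩ := Submodule.Quotient.mk_surjective _ s
      rw [← Submodule.Quotient.mk_smul, Submodule.Quotient.mk_eq_zero, smul_eq_mul,
        (commute_central σ G r).eq]
      exact Ideal.mul_mem_left _ _ hmem
    by_contra hlt
    refine central_ne_zero hσ hG (eq_zero_of_mem_span hσ (central_ne_zero hσ hFm.ne_zero) h1
      fun i hi => coeff_eq_zero_of_natDegree_lt (lt_of_lt_of_le ?_ hi))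
    rw [natDegree_central hσ hG, natDegree_central hσ hFm.ne_zero]
    exact Nat.mul_lt_mul_of_pos_right (by omega) hn
  refine ⟨fun hu => ?_, fun G H hGH => ?_⟩
  · have h1 : F = 1 := hFm.eq_one_of_isUnit hu
    have h2 : central σ F = 1 := by rw [h1, ← centralHom_apply, map_one]
    rw [h2, Ideal.span_singleton_one, Module.annihilator_eq_top_iff] at h
    have := IsSimpleModule.nontrivial (SkewRing σ)
      (SkewRing σ ⧸ (Ideal.span {f} : Ideal (SkewRing σ)))
    exact not_subsingleton _ h
  · have hG : G ≠ 0 := left_ne_zero_of_mul (hGH ▸ hFm.ne_zero)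
    have hH : H ≠ 0 := right_ne_zero_of_mul (hGH ▸ hFm.ne_zero)
    have hd : F.natDegree = G.natDegree + H.natDegree := by
      rw [hGH, Polynomial.natDegree_mul hG hH]
    have hprod : centerToEigenring f ⟨central σ G, central_mem_center G⟩ *
        centerToEigenring f ⟨central σ H, central_mem_center H⟩ = 0 := by
      rw [← map_mul]
      have h1 : (⟨central σ G, central_mem_center G⟩ * ⟨central σ H, central_mem_center H⟩ :
          Subring.center (SkewRing σ)) = ⟨central σ F, central_mem_center F⟩ :=
        Subtype.ext (by
          change central σ G * central σ H = central σ F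
          rw [hGH, central_mul])
      rw [h1, hcent]
      obtain ⟨w, hw⟩ := dvd_central_of_annihilator_eq hσ hFm.ne_zero h
      rw [← mul_eq_central_comm hσ hFm.ne_zero hw.symm]
      exact Ideal.mem_span_singleton'.2 ⟨w, rfl⟩
    have hunit : ∀ P : K[X], P ≠ 0 → P.natDegree = 0 → IsUnit P := by
      intro P hP hP0
      rw [Polynomial.eq_C_of_natDegree_eq_zero hP0]
      exact (IsUnit.mk0 _ fun h0 => hP (by
        rw [Polynomial.eq_C_of_natDegree_eq_zero hP0, h0, map_zero])).map _
    by_cases h1 : centerToEigenring f ⟨central σ G, central_mem_center G⟩ = 0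
    · right
      have := hdeg G hG ((hcent G).1 h1)
      exact hunit H hH (by omega)
    · left
      have h2 := (hD.2 _ h1).mul_right_eq_zero.1 hprod
      have := hdeg H hH ((hcent H).1 h2)
      exact hunit G hG (by omega)

end SkewRing

theorem mainTheorem4 {K L : Type*} [Field K] [Field L] [Algebra K L] [FiniteDimensional K L]
    [IsGalois K L] (σ : L ≃ₐ[K] L) (hσ : ∀ τ : L ≃ₐ[K] L, τ ∈ Subgroup.zpowers σ)
    (n : ℕ) (hn : n = Module.finrank K L) :
    -- the norm of the constant coefficient of an irreducible polynomial with bound `F(x ^ n)`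
    (∀ (F : Polynomial K) (f : SkewRing σ) (m s ℓ : ℕ), F.Monic → f.Monic → Irreducible f →
      f.coeff 0 ≠ 0 → IsBound f (SkewRing.central σ F) →
      IsProductOfIrreducibles (SkewRing.central σ F) m →
      s = F.natDegree → ℓ = n / m →
      m ∣ n ∧ (f.natDegree = s * ℓ →
        Algebra.norm K (f.coeff 0) = (-1) ^ (s * ℓ * (n - 1)) * F.coeff 0 ^ ℓ)) ∧
    -- the norm of the constant coefficient of a monic divisor of `F(x ^ n)`
    (∀ (F : Polynomial K) (m s ℓ : ℕ), F.Monic → Irreducible F →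
      IsProductOfIrreducibles (SkewRing.central σ F) m → s = F.natDegree → ℓ = n / m →
      m ∣ n ∧ ∀ (g : SkewRing σ) (h : ℕ), 1 ≤ h → h ≤ m → g.Monic →
        g ∣ SkewRing.central σ F → g.natDegree = s * h * ℓ →
        Algebra.norm K (g.coeff 0) = (-1) ^ (s * h * ℓ * (n - 1)) * F.coeff 0 ^ (h * ℓ)) ∧
    -- the rank bound in `M_m(E(f))`
    (∀ (F : Polynomial K) (f : SkewRing σ) (m s ℓ : ℕ), F.Monic → Irreducible F →
      F ≠ Polynomial.X → IsProductOfIrreducibles (SkewRing.central σ F) m →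
      s = F.natDegree → ℓ = n / m →
      Irreducible f → f ∣ SkewRing.central σ F →
      m ∣ n ∧ IsDivRing (Eigenring f) ∧
      (∃ φ : SkewRing.RF σ F ≃+* Matrix (Fin m) (Fin m) (Eigenring f), SkewRing.IsCenterLinear σ φ) ∧
      ∀ (φ : SkewRing.RF σ F ≃+* Matrix (Fin m) (Fin m) (Eigenring f)) (k : ℕ) (a : SkewRing σ),
        k ≤ m → a ≠ 0 → a.natDegree ≤ s * k * ℓ →
        m - k ≤ matrixRank (φ (SkewRing.toRF σ F a)) ∧
        (matrixRank (φ (SkewRing.toRF σ F a)) = m - k →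
          a.natDegree = s * k * ℓ ∧
          Algebra.norm K (a.coeff 0) / Algebra.norm K (a.coeff (s * k * ℓ)) =
            (-1) ^ (s * k * ℓ * (n - 1)) * F.coeff 0 ^ (k * ℓ))) := by
  subst hn
  -- the norm of a monic divisor of `F(x ^ n)` for irreducible `F`, in terms of its degree `s j`
  have part2 : ∀ (F : Polynomial K), F.Monic → Irreducible F → ∀ (g w : SkewRing σ) (j : ℕ),
      g.Monic → SkewRing.central σ F = g * w → g.natDegree = F.natDegree * j →
      Algebra.norm K (g.coeff 0) =
        (-1) ^ (F.natDegree * j * (Module.finrank K L - 1)) * F.coeff 0 ^ j := by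
    intro F hFm hF g w j hgm hg hd
    obtain ⟨i, γ, hi⟩ := SkewRing.exists_reducedNorm_eq_of_mul_eq_central hσ hF hg.symm
    obtain ⟨hd', hnorm⟩ := SkewRing.norm_coeff_zero_of_reducedNorm_eq hσ hgm.ne_zero hFm hi
    have hij : i = j := Nat.eq_of_mul_eq_mul_left hF.natDegree_pos (by rw [← hd, hd', mul_comm])
    have hlead : g.coeff g.natDegree = 1 := hgm
    rw [hnorm, hlead, map_one, mul_one, hd, hij]
  refine ⟨?_, ?_, ?_⟩
  · rintro F f m _ _ hFm hfm hf - ⟨-, hbound⟩ hm rfl rfl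
    have := SkewRing.isSimpleModule_quotient hσ hf
    -- `E(f)` is a division ring, so the bound `F(x ^ n)` comes from an irreducible `F`
    have hF := SkewRing.irreducible_of_annihilator_eq hσ hFm hf hbound.symm
    obtain ⟨w, hw⟩ := SkewRing.dvd_central_of_annihilator_eq hσ hF.ne_zero hbound.symm
    refine ⟨(SkewRing.dvd_finrank_and_natDegree_eq hσ hFm hF hm).1, fun hd => ?_⟩
    exact part2 F hFm hF f w _ hfm hw hd
  · rintro F m _ _ hFm hF hm rfl rfl
    refine ⟨(SkewRing.dvd_finrank_and_natDegree_eq hσ hFm hF hm).1, ?_⟩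
    rintro g h - - hgm ⟨w, hw⟩ hd
    rw [mul_assoc] at hd
    rw [part2 F hFm hF g w _ hgm hw hd, mul_assoc F.natDegree h]
  · rintro F f m _ _ hFm hF hX hm rfl rfl hf hfF
    have h0 := SkewRing.coeff_zero_ne_zero_of_ne_X hFm hF hX
    have hD := isDivRing_eigenring (SkewRing.isSimpleModule_quotient hσ hf)
    refine ⟨(SkewRing.dvd_finrank_and_natDegree_eq hσ hFm hF hm).1, hD,
      SkewRing.exists_isCenterLinear hσ hFm hF h0 hm hf hfF, fun φ k a hk ha hda => ?_⟩
    -- `a = g c` with `deg g = (m - r) s ℓ`, where `r` is the rank of `a`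
    obtain ⟨g, c, h, hac, hgh, hdeg⟩ := SkewRing.exists_gcd_natDegree_eq hσ hFm hF hm hD φ a
    set r := matrixRank (φ (SkewRing.toRF σ F a)) with hr
    set ℓ := Module.finrank K L / m with hℓ
    have hg0 : g ≠ 0 := by
      rintro rfl
      exact ha (by rw [hac, zero_mul])
    have hc0 : c ≠ 0 := by
      rintro rfl
      exact ha (by rw [hac, mul_zero])
    have hadeg : a.natDegree = g.natDegree + c.natDegree := by
      rw [hac, SkewRing.natDegree_mul hσ hg0 hc0]
    have hs : 0 < F.natDegree := hF.natDegree_pos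
    have hℓ0 : 0 < ℓ := by
      have h1 := (SkewRing.dvd_finrank_and_natDegree_eq hσ hFm hF hm).2 f hf hfF
      refine Nat.pos_of_ne_zero fun h2 => hf.not_isUnit ((SkewRing.isUnit_iff hσ hf.ne_zero).2 ?_)
      rw [h1, ← hℓ, h2, mul_zero]
    refine ⟨?_, fun hrk => ?_⟩
    · have h1 : F.natDegree * m * ℓ ≤ F.natDegree * (k + r) * ℓ := by
        calc F.natDegree * m * ℓ = g.natDegree + F.natDegree * r * ℓ := hdeg.symm
          _ ≤ F.natDegree * k * ℓ + F.natDegree * r * ℓ := by omega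
          _ = F.natDegree * (k + r) * ℓ := by ring
      have h2 := Nat.le_of_mul_le_mul_left (Nat.le_of_mul_le_mul_right h1 hℓ0) hs
      omega
    · -- here `deg a ≤ s k ℓ = deg g`, so `c` is a constant and the reduced norm of `a` is, like that
      -- of `g`, a power of `F` up to a constant
      have hgd : g.natDegree = F.natDegree * k * ℓ := by
        obtain ⟨t, rfl⟩ := Nat.exists_eq_add_of_le hk
        rw [hrk, Nat.add_sub_cancel_left] at hdeg
        have : F.natDegree * (k + t) * ℓ = F.natDegree * k * ℓ + F.natDegree * t * ℓ := by ring
        omega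
      have had : a.natDegree = F.natDegree * k * ℓ := by omega
      refine ⟨had, ?_⟩
      obtain ⟨i, γ, hi⟩ := SkewRing.exists_reducedNorm_eq_of_mul_eq_central hσ hF hgh.symm
      have hai : SkewRing.reducedNorm σ a = Polynomial.C (γ * (SkewRing.reducedNorm σ c).coeff 0) *
          F.map (algebraMap K L) ^ i := by
        have h1 : SkewRing.reducedNorm σ c = Polynomial.C ((SkewRing.reducedNorm σ c).coeff 0) :=
          Polynomial.eq_C_of_natDegree_eq_zero (by
            rw [(SkewRing.natDegree_reducedNorm hσ hc0).2]
            omega)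
        rw [hac, map_mul, hi, map_mul Polynomial.C, ← h1]
        ring
      obtain ⟨hd', hnorm⟩ := SkewRing.norm_coeff_zero_of_reducedNorm_eq hσ ha hFm hai
      have hik : i = k * ℓ := Nat.eq_of_mul_eq_mul_left hs (by
        rw [← mul_assoc, ← had, hd', mul_comm])
      have hlead : Algebra.norm K (a.coeff (F.natDegree * k * ℓ)) ≠ 0 := by
        rw [Ne, Algebra.norm_eq_zero_iff, ← had]
        exact SkewRing.coeff_natDegree_ne_zero ha
      rw [hnorm, had, hik, div_eq_iff hlead]
      ring
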